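/- **Theorem 4.1 (largest branch of Hoppe trees).** A recursive tree on $n$ nodes is a rooted tree on $\{1,\dots,n\}$ with root $1$ in which every node $j\in\{2,\dots,n\}$ is attached to a parent in $\{1,\dots,j-1\}$. For $\theta>0$, the Hoppe tree $\mathcal T_n^\theta$ is the random recursive tree on $n$ nodes in which, independently for $j=2,\dots,n$, node $j$ is attached to the root with probability $\frac{\theta}{\theta+j-2}$ and to each other earlier node with probability $\frac{1}{\theta+j-2}$. The uniform recursive tree (URT) $\mathcal T_n$ is uniformly distributed on the recursive trees on $n$ nodes. A branch of a tree consists of a child of the root together with all its descendants, and $\nu_n(\mathcal T)$ denotes the number of nodes in the largest branch of $\mathcal T$. For $k\ge 1$ and $x>0$ let $$\mathcal S_k(x)=\Big\{(y_1,\dots,y_k)\in\mathbb R^k:\ y_1>\tfrac1x,\dots,y_k>\tfrac1x,\ \sum_{j=1}^k y_j<1\Big\}.$$ (i) Let $\theta>0$. Then $\nu_n(\mathcal T_n^\theta)/n$ converges weakly, as $n\to\infty$, to a random variable $\nu$ whose cumulative distribution function is $0$ for $x\le 0$ and is $$F_\theta(x)=e^{\gamma\theta}x^{\theta-1}\,\Gamma(\theta)\,p_\theta(1/x)\qquad\text{for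 } x>0,$$ where $\gamma$ is Euler's constant and, for $x>0$, $$p_\theta(x)=\frac{e^{-\gamma\theta}x^{\theta-1}}{\Gamma(\theta)}\left(1+\sum_{k=1}^\infty\frac{(-\theta)^k}{k!}\int\!\cdots\!\int_{\mathcal S_k(x)}\Big(1-\sum_{j=1}^k y_j\Big)^{\theta-1}\frac{dy_1\cdots dy_k}{y_1\cdots y_k}\right);$$ here all the integrals and the series converge absolutely. (ii) For the URT, $\nu_n(\mathcal T_n)/n$ converges weakly to a random variable $\nu$ whose cumulative distribution function is $$F_1(x)=\begin{cases}0,& x\le 0,\\[2pt] 1+\displaystyle\sum_{k=1}^\infty\frac{(-1)^k}{k!}\int\!\cdots\!\int_{\mathcal S_k(1/x)}\frac{dy_1\cdots dy_k}{y_1\cdots y_k},& 0<x\le 1,\\[2pt] 1,& x>1.\end{cases}$$ This $\nu$ is integrable and $\mathbb E[\nu]\ge\frac12$. Moreover, for every $c\in[\frac12,1]$, $$\lim_{n\to\infty}\mathbb P\big(\nu_n(\mathcal T_n)\le cn\big)=1-\ln(c^{-1}),$$ and $\mathbb E[\nu_n(\mathcal T_n)]\ge\frac n2$ for every $n\ge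 2$. -/

import Mathlib

open MeasureTheory ProbabilityTheory Filter Topology
open scoped Nat

/-- A recursive tree on the nodes `1, …, n`, given by its parent function: every node
`j ∈ {2, …, n}` is attached to a node of `{1, …, j - 1}`. The root is node `1`. -/
abbrev RecursiveTree (n : ℕ) : Type :=
  (j : Finset.Icc 2 n) → Finset.Ico 1 (j : ℕ)

namespace RecursiveTree

instance instNonempty (n : ℕ) : Nonempty (RecursiveTree n) :=
  ⟨fun j => ⟨1, Finset.mem_Ico.2 ⟨le_rfl, (Finset.mem_Icc.1 j.2).1⟩⟩⟩

variable {n : ℕ}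

/-- Node `b` is a child of node `a`. -/
def IsChild (T : RecursiveTree n) (a b : ℕ) : Prop :=
  ∃ h : b ∈ Finset.Icc 2 n, (T ⟨b, h⟩ : ℕ) = a

/-- The node `i` together with all its descendants. -/
def subtree (T : RecursiveTree n) (i : ℕ) : Set ℕ :=
  {b | Relation.ReflTransGen T.IsChild i b}

/-- The number of branches of size `s`, a branch being a child of the root together with all its
descendants. -/
noncomputable def numBranches (T : RecursiveTree n) (s : ℕ) : ℕ :=
  {i : ℕ | T.IsChild 1 i ∧ (T.subtree i).ncard = s}.ncard

/-- The number of nodes in the largest branch (`0` if the tree has no branch, that is, `n ≤ 1`). -/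
noncomputable def largestBranch (T : RecursiveTree n) : ℕ :=
  sSup {s : ℕ | s ∈ Finset.Icc 1 (n - 1) ∧ 1 ≤ T.numBranches s}

/-- The probability that the random attachments of the Hoppe tree produce `T`: independently of the
other nodes, node `j` attaches to the root with probability `θ / (θ + j - 2)` and to any other
earlier node with probability `1 / (θ + j - 2)`. -/
noncomputable def hoppeWeight (θ : ℝ) (T : RecursiveTree n) : ℝ :=
  ∏ j : Finset.Icc 2 n, (if (T j : ℕ) = 1 then θ else 1) / (θ + (j : ℕ) - 2)

theorem hoppe_attach_sum {θ : ℝ} (hθ : 0 < θ) {j : ℕ} (hj : 2 ≤ j) :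
    ∑ i : Finset.Ico 1 j, (if (i : ℕ) = 1 then θ else 1) / (θ + (j : ℕ) - 2) = 1 := by
  have hj' : (2 : ℝ) ≤ j := by exact_mod_cast hj
  have hne : θ + (j : ℝ) - 2 ≠ 0 := by linarith
  rw [Finset.sum_coe_sort (Finset.Ico 1 j)
    (fun i : ℕ => (if i = 1 then θ else 1) / (θ + (j : ℝ) - 2)), ← Finset.sum_div,
    div_eq_one_iff_eq hne, Finset.sum_eq_sum_Ico_succ_bot (by omega)]
  have h : ∑ k ∈ Finset.Ico (1 + 1) j, (if k = 1 then θ else (1 : ℝ)) =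
      ∑ k ∈ Finset.Ico (1 + 1) j, (1 : ℝ) :=
    Finset.sum_congr rfl fun k hk => if_neg (by have := (Finset.mem_Ico.1 hk).1; omega)
  rw [h]
  simp only [if_true, Finset.sum_const, Nat.card_Ico, nsmul_eq_mul, mul_one]
  rw [Nat.cast_sub (by omega)]
  push_cast
  ring

theorem hoppeWeight_nonneg {θ : ℝ} (hθ : 0 < θ) (T : RecursiveTree n) :
    0 ≤ hoppeWeight θ T := by
  refine Finset.prod_nonneg fun j _ => div_nonneg (by split_ifs <;> linarith) ?_
  have hj : (2 : ℝ) ≤ ((j : ℕ) : ℝ) := by exact_mod_cast (Finset.mem_Icc.1 j.2).1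
  linarith

theorem sum_hoppeWeight {θ : ℝ} (hθ : 0 < θ) (n : ℕ) :
    ∑ T : RecursiveTree n, hoppeWeight θ T = 1 := by
  unfold hoppeWeight
  rw [← Fintype.prod_sum (fun (j : Finset.Icc 2 n) (i : Finset.Ico 1 (j : ℕ)) =>
    (if (i : ℕ) = 1 then θ else 1) / (θ + ((j : ℕ) : ℝ) - 2))]
  exact Finset.prod_eq_one fun j _ => hoppe_attach_sum hθ (Finset.mem_Icc.1 j.2).1

end RecursiveTree

/-- The law of the Hoppe tree on `n` nodes with root weight `θ`. -/
noncomputable def hoppeTree (θ : ℝ) (hθ : 0 < θ) (n : ℕ) : PMF (RecursiveTree n) :=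
  PMF.ofFintype (fun T => ENNReal.ofReal (T.hoppeWeight θ)) (by
    rw [← ENNReal.ofReal_sum_of_nonneg fun T _ => RecursiveTree.hoppeWeight_nonneg hθ T,
      RecursiveTree.sum_hoppeWeight hθ n, ENNReal.ofReal_one])

/-- The law of the uniform recursive tree (URT) on `n` nodes: all recursive trees are equally
likely. -/
noncomputable def uniformRecursiveTree (n : ℕ) : PMF (RecursiveTree n) :=
  PMF.uniformOfFintype (RecursiveTree n)

/-- `S_k(x) = {y_1 > 1/x, …, y_k > 1/x, y_1 + ⋯ + y_k < 1}`. -/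
def simplexRegion (k : ℕ) (x : ℝ) : Set (Fin k → ℝ) :=
  {y | (∀ j, 1 / x < y j) ∧ ∑ j, y j < 1}

/-- The integrand `(1 - ∑ y_j)^(θ - 1) / (y_1 ⋯ y_k)`. -/
noncomputable def simplexIntegrand (θ : ℝ) (k : ℕ) (y : Fin k → ℝ) : ℝ :=
  (1 - ∑ j, y j) ^ (θ - 1) / ∏ j, y j

/-- The `k`-th term `(-θ)^k / k! · ∫_{S_k(x)} (1 - ∑ y_j)^(θ - 1) dy_1 ⋯ dy_k / (y_1 ⋯ y_k)`. -/
noncomputable def kingmanTerm (θ : ℝ) (k : ℕ) (x : ℝ) : ℝ :=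
  (-θ) ^ k / (k ! : ℝ) * ∫ y in simplexRegion k x, simplexIntegrand θ k y

/-- The function `p_θ`; the series runs over `k ≥ 1`. -/
noncomputable def kingmanP (θ x : ℝ) : ℝ :=
  Real.exp (-(Real.eulerMascheroniConstant * θ)) * x ^ (θ - 1) / Real.Gamma θ *
    (1 + ∑' k : ℕ, kingmanTerm θ (k + 1) x)

/-- The function `F_θ`, to be used for `x > 0`. -/
noncomputable def kingmanF (θ x : ℝ) : ℝ :=
  Real.exp (Real.eulerMascheroniConstant * θ) * x ^ (θ - 1) * Real.Gamma θ * kingmanP θ (1 / x)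

/-- The explicit distribution function for `θ = 1`; note
`S_k(1/x) = {y_1 > x, …, y_k > x, y_1 + ⋯ + y_k < 1}`. -/
noncomputable def urtF (x : ℝ) : ℝ :=
  if x ≤ 0 then 0
  else if x ≤ 1 then
    1 + ∑' k : ℕ, (-1) ^ (k + 1) / ((k + 1)! : ℝ) *
      ∫ y in simplexRegion (k + 1) (1 / x), 1 / ∏ j, y j
  else 1

/-! A new node starts a branch with weight `θ` and joins an existing branch with weight equal to its
size. The branch sizes of the Hoppe tree on `m + 1` nodes are therefore the table sizes of a Chinese
restaurant process with `m` customers (`RecursiveTree.sum_hoppeWeight_mul`).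

The Palm formula `crp_palmSum` removes a marked table of size `s` at the price of a factor `θ / s`,
leaving the same process on `m - s` customers. Iterated with the indicator of `s > t`, it writes the
factorial moments of the number of tables larger than `t` as iterated convolutions. For `t = x * n`
fewer than `1 / x` tables can be that large, so inclusion-exclusion gives the probability that there
is none as an alternating sum whose length does not depend on `n` (`crp_forall_le`).

The total weights behave like `m ^ (θ - 1) / Γ(θ)` by Euler's limit for `Γ`. The convolutions,
written as integrals of step functions, converge by dominated convergence (`tendsto_scaledMoment`),
and Tonelli identifies the limits with the integrals over `S_k` (`lintegral_truncatedIntegrand`).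
Hence the distribution functions converge for every `x > 0` (`tendsto_hoppeCdf`).

The limit is a distribution function: monotonicity passes to the limit, right continuity at `x > 0`
is dominated convergence, and no mass escapes to `0` because the probability of a largest branch of
size at most `x * n` is at most `C * x` uniformly in `n` (`exists_hoppeCdf_le`).

For the URT, `θ = 1`. When `c ≥ 1/2` two branches larger than `c * n` do not fit, so only the term
`k = 1` survives. The mean bound compares the expected sum of squared branch sizes, computed by the
Palm formula, with `n - 1` times the largest branch. -/

/-! ### The Chinese restaurant process and its Palm formula -/

/-- The sum of `h s * f (l - s)` over the blocks `s` of `l`. -/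
def palmSum (h : ℕ → ℝ) (f : Multiset ℕ → ℝ) (l : Multiset ℕ) : ℝ :=
  (l.map fun s => h s * f (l.erase s)).sum

/-- One unnormalised step of the Chinese restaurant process, acting on functions of the multiset of
table sizes. -/
def growth (θ : ℝ) (f : Multiset ℕ → ℝ) (l : Multiset ℕ) : ℝ :=
  θ * f (1 ::ₘ l) + (l.map fun s : ℕ => (s : ℝ) * f ((s + 1) ::ₘ l.erase s)).sum

/-- The weighted sum of `f` over the configurations of the Chinese restaurant process with `m`
customers, divided by `m!`. -/
noncomputable def crp (θ : ℝ) : ℕ → (Multiset ℕ → ℝ) → ℝ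
  | 0, f => f 0
  | m + 1, f => crp θ m (growth θ f) / (m + 1)

theorem Multiset.erase_cons_of_mem {s a : ℕ} {l : Multiset ℕ} (h : s ∈ l) :
    (a ::ₘ l).erase s = a ::ₘ l.erase s := by
  by_cases hs : s = a
  · subst hs
    rw [Multiset.erase_cons_head, Multiset.cons_erase h]
  · exact Multiset.erase_cons_tail l (fun h' => hs h'.symm)

theorem palmSum_cons (h : ℕ → ℝ) (f : Multiset ℕ → ℝ) (a : ℕ) (l : Multiset ℕ) :
    palmSum h f (a ::ₘ l) = h a * f l + palmSum h (fun l' => f (a ::ₘ l')) l := by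
  unfold palmSum
  rw [Multiset.map_cons, Multiset.sum_cons, Multiset.erase_cons_head]
  congr 2
  refine Multiset.map_congr rfl fun s hs => ?_
  rw [Multiset.erase_cons_of_mem hs]

theorem sum_map_erase_cons (F : ℕ → Multiset ℕ → ℝ) (a : ℕ) (l : Multiset ℕ) :
    ((a ::ₘ l).map fun s => F s ((a ::ₘ l).erase s)).sum =
      F a l + (l.map fun s => F s (a ::ₘ l.erase s)).sum := by
  rw [Multiset.map_cons, Multiset.sum_cons, Multiset.erase_cons_head]
  congr 2
  refine Multiset.map_congr rfl fun s hs => ?_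
  rw [Multiset.erase_cons_of_mem hs]

/-- Ordered pairs of distinct blocks may be listed starting from either member. -/
theorem sum_map_erase_comm (l : Multiset ℕ) (G : ℕ → ℕ → Multiset ℕ → ℝ) :
    (l.map fun s => ((l.erase s).map fun t => G s t ((l.erase s).erase t)).sum).sum =
      (l.map fun s => ((l.erase s).map fun t => G t s ((l.erase s).erase t)).sum).sum := by
  induction l using Multiset.induction_on generalizing G with
  | empty => simp
  | cons a l ih =>
    rw [sum_map_erase_cons (fun s l' => (l'.map fun t => G s t (l'.erase t)).sum),
      sum_map_erase_cons (fun s l' => (l'.map fun t => G t s (l'.erase t)).sum)]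
    simp only [fun s => sum_map_erase_cons (G s) a,
      fun s => sum_map_erase_cons (fun t l' => G t s l') a]
    rw [Multiset.sum_map_add, Multiset.sum_map_add, ih fun s t l' => G s t (a ::ₘ l')]
    ring

/-- A Leibniz rule. The new customer opens the marked table, joins the marked table, or changes the
unmarked rest; these are the three summands. `sum_map_erase_comm` exchanges the marked table with
the growing one. -/
theorem growth_palmSum (θ : ℝ) (h : ℕ → ℝ) (f : Multiset ℕ → ℝ) (l : Multiset ℕ) :
    growth θ (palmSum h f) l =
      θ * h 1 * f l + palmSum (fun s => (s : ℝ) * h (s + 1)) f l + palmSum h (growth θ f) l := by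
  have key := sum_map_erase_comm l (fun s t l' => (s : ℝ) * (h t * f ((s + 1) ::ₘ l')))
  have e1 : ∀ s : ℕ, (s : ℝ) * palmSum h f ((s + 1) ::ₘ l.erase s) =
      s * h (s + 1) * f (l.erase s) + ((l.erase s).map fun t : ℕ =>
        (s : ℝ) * (h t * f ((s + 1) ::ₘ (l.erase s).erase t))).sum := by
    intro s
    rw [palmSum_cons, mul_add, ← mul_assoc]
    unfold palmSum
    rw [Multiset.sum_map_mul_left]
  have e2 : ∀ s : ℕ, h s * growth θ f (l.erase s) =
      θ * (h s * f (1 ::ₘ l.erase s)) + ((l.erase s).map fun t : ℕ =>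
        (t : ℝ) * (h s * f ((t + 1) ::ₘ (l.erase s).erase t))).sum := by
    intro s
    unfold growth
    rw [mul_add, ← Multiset.sum_map_mul_left]
    congr 1
    · ring
    · congr 1
      refine Multiset.map_congr rfl fun t _ => by ring
  have e3 : palmSum h (growth θ f) l = (l.map fun s => h s * growth θ f (l.erase s)).sum := rfl
  have e4 : palmSum (fun s => (s : ℝ) * h (s + 1)) f l =
    (l.map fun s : ℕ => (s : ℝ) * h (s + 1) * f (l.erase s)).sum := rfl
  rw [e3, e4]
  conv_lhs => unfold growth
  simp only [e1, e2, Multiset.sum_map_add]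
  rw [key, palmSum_cons, Multiset.sum_map_mul_left]
  unfold palmSum
  ring

theorem crp_add (θ : ℝ) (m : ℕ) (f g : Multiset ℕ → ℝ) :
    crp θ m (fun l => f l + g l) = crp θ m f + crp θ m g := by
  induction m generalizing f g with
  | zero => rfl
  | succ m ih =>
    have : growth θ (fun l => f l + g l) = fun l => growth θ f l + growth θ g l := by
      funext l
      simp only [growth, mul_add, Multiset.sum_map_add]
      ring
    simp only [crp, this, ih, add_div]

theorem crp_const_mul (θ : ℝ) (m : ℕ) (c : ℝ) (f : Multiset ℕ → ℝ) :
    crp θ m (fun l => c * f l) = c * crp θ m f := by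
  induction m generalizing f with
  | zero => rfl
  | succ m ih =>
    have : growth θ (fun l => c * f l) = fun l => c * growth θ f l := by
      funext l
      simp only [growth, mul_add, mul_left_comm _ c, Multiset.sum_map_mul_left]
    simp only [crp, this, ih, mul_div_assoc]

/-- The Palm formula for the Chinese restaurant process. -/
theorem crp_palmSum (θ : ℝ) (h : ℕ → ℝ) (f : Multiset ℕ → ℝ) (m : ℕ) :
    crp θ m (palmSum h f) =
      ∑ p ∈ Finset.HasAntidiagonal.antidiagonal m, θ / p.1 * h p.1 * crp θ p.2 f := by
  induction m generalizing h f with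
  | zero => simp [crp, palmSum]
  | succ m ih =>
    have h1 : crp θ (m + 1) (palmSum h f) = (θ * h 1 * crp θ m f +
        crp θ m (palmSum (fun s => (s : ℝ) * h (s + 1)) f) + crp θ m (palmSum h (growth θ f))) /
          (m + 1) := by
      simp only [crp]
      rw [funext (growth_palmSum θ h f), crp_add, crp_add, crp_const_mul]
    have h2 : ∀ j : ℕ, crp θ j (growth θ f) = (j + 1) * crp θ (j + 1) f := by
      intro j
      simp only [crp]
      field_simp
    have hm : (m : ℝ) + 1 ≠ 0 := by positivity
    rw [h1, ih, ih, div_eq_iff hm]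
    -- With the factor `m + 1` cleared, it is split as `p.1 + p.2`: growth of the rest accounts for
    -- `p.2`, creation and growth of the marked block for `p.1`. Terms with `p.1 = 0` vanish since
    -- `θ / 0 = 0`.
    have h3 : ∑ p ∈ Finset.HasAntidiagonal.antidiagonal m, θ / p.1 * h p.1 * crp θ p.2 (growth θ f) =
        ∑ p ∈ Finset.HasAntidiagonal.antidiagonal (m + 1), p.2 * (θ / p.1 * h p.1 * crp θ p.2 f) := by
      rw [Finset.Nat.sum_antidiagonal_succ']
      simp only [Nat.cast_zero, zero_mul, zero_add, h2]
      refine Finset.sum_congr rfl fun p _ => ?_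
      push_cast
      ring
    have h4 : θ * h 1 * crp θ m f +
        ∑ p ∈ Finset.HasAntidiagonal.antidiagonal m, θ / p.1 * (p.1 * h (p.1 + 1)) * crp θ p.2 f =
        ∑ p ∈ Finset.HasAntidiagonal.antidiagonal (m + 1), p.1 * (θ / p.1 * h p.1 * crp θ p.2 f) := by
      rw [Finset.Nat.sum_antidiagonal_succ]
      simp only [Nat.cast_zero, zero_mul, zero_add]
      cases m with
      | zero => simp
      | succ m =>
        rw [Finset.Nat.sum_antidiagonal_succ, Finset.Nat.sum_antidiagonal_succ]
        simp only [Nat.cast_zero, div_zero, zero_mul, zero_add, Nat.cast_one]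
        congr 1
        · ring
        · refine Finset.sum_congr rfl fun p _ => ?_
          push_cast
          field_simp
    rw [h4, h3, ← Finset.sum_add_distrib, Finset.sum_mul]
    refine Finset.sum_congr rfl fun p hp => ?_
    have hp' : (p.1 : ℝ) + p.2 = m + 1 := by exact_mod_cast Finset.HasAntidiagonal.mem_antidiagonal.1 hp
    rw [← add_mul, hp', mul_comm]

/-- Each step raises the total size by exactly one, so `crp θ m` only sees multisets of sum `m`. -/
theorem growth_congr {θ : ℝ} {f g : Multiset ℕ → ℝ} {m : ℕ}
    (h : ∀ l : Multiset ℕ, l.sum = m + 1 → f l = g l) {l : Multiset ℕ} (hl : l.sum = m) :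
    growth θ f l = growth θ g l := by
  unfold growth
  rw [h (1 ::ₘ l) (by simp [hl, add_comm])]
  congr 2
  refine Multiset.map_congr rfl fun s hs => ?_
  rw [h _ ?_]
  have := congrArg Multiset.sum (Multiset.cons_erase hs)
  simp only [Multiset.sum_cons] at this ⊢
  omega

theorem crp_congr {θ : ℝ} {m : ℕ} {f g : Multiset ℕ → ℝ}
    (h : ∀ l : Multiset ℕ, l.sum = m → f l = g l) : crp θ m f = crp θ m g := by
  induction m generalizing f g with
  | zero => exact h 0 rfl
  | succ m ih => simp only [crp, ih fun l hl => growth_congr h hl]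

theorem crp_mono {θ : ℝ} (hθ : 0 < θ) {m : ℕ} {f g : Multiset ℕ → ℝ}
    (h : ∀ l : Multiset ℕ, l.sum = m → f l ≤ g l) : crp θ m f ≤ crp θ m g := by
  induction m generalizing f g with
  | zero => exact h 0 rfl
  | succ m ih =>
    simp only [crp]
    gcongr
    refine ih fun l hl => ?_
    unfold growth
    refine add_le_add (mul_le_mul_of_nonneg_left (h _ (by simp [hl, add_comm])) hθ.le)
      (Multiset.sum_map_le_sum_map _ _ fun (s : ℕ) hs =>
        mul_le_mul_of_nonneg_left (h _ ?_) s.cast_nonneg)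
    have := congrArg Multiset.sum (Multiset.cons_erase hs)
    simp only [Multiset.sum_cons] at this ⊢
    omega

/-- The normalised total weight `θ (θ + 1) ⋯ (θ + m - 1) / m!`. -/
noncomputable def crpMass (θ : ℝ) (m : ℕ) : ℝ := crp θ m fun _ => 1

theorem crpMass_zero (θ : ℝ) : crpMass θ 0 = 1 := rfl

theorem crpMass_succ (θ : ℝ) (m : ℕ) :
    crpMass θ (m + 1) = (θ + m) / (m + 1) * crpMass θ m := by
  have h : crp θ m (growth θ fun _ => 1) = crp θ m fun _ => (θ + m) * 1 := by
    refine crp_congr fun l hl => ?_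
    simp only [growth, mul_one, add_right_inj]
    rw [← hl, Nat.cast_multiset_sum]
  unfold crpMass
  simp only [crp]
  rw [h, crp_const_mul]
  ring

theorem crpMass_pos {θ : ℝ} (hθ : 0 < θ) (m : ℕ) : 0 < crpMass θ m := by
  induction m with
  | zero => simp [crpMass_zero]
  | succ m ih => rw [crpMass_succ]; positivity

/-! ### Branch sizes of the Hoppe tree -/

namespace RecursiveTree

/-- The parent of a node, and `0` for numbers that are not non-root nodes. -/
def parent {n : ℕ} (T : RecursiveTree n) (j : ℕ) : ℕ :=
  if h : j ∈ Finset.Icc 2 n then T ⟨j, h⟩ else 0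

theorem isChild_iff {n : ℕ} {T : RecursiveTree n} {a b : ℕ} :
    T.IsChild a b ↔ b ∈ Finset.Icc 2 n ∧ T.parent b = a := by
  unfold IsChild parent
  constructor
  · rintro ⟨h, rfl⟩
    exact ⟨h, dif_pos h⟩
  · rintro ⟨h, hb⟩
    exact ⟨h, by rwa [dif_pos h] at hb⟩

theorem parent_mem {n : ℕ} (T : RecursiveTree n) {b : ℕ} (h : b ∈ Finset.Icc 2 n) :
    T.parent b ∈ Finset.Ico 1 b := by
  rw [parent, dif_pos h]
  exact (T ⟨b, h⟩).2

theorem IsChild.lt {n : ℕ} {T : RecursiveTree n} {a b : ℕ} (h : T.IsChild a b) : a < b := by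
  obtain ⟨hb, rfl⟩ := isChild_iff.1 h
  exact (Finset.mem_Ico.1 (T.parent_mem hb)).2

theorem le_of_mem_subtree {n : ℕ} {T : RecursiveTree n} {a b : ℕ} (h : b ∈ T.subtree a) :
    a ≤ b := by
  change Relation.ReflTransGen T.IsChild a b at h
  induction h with
  | refl => exact le_rfl
  | tail _ h ih => exact ih.trans h.lt.le

theorem mem_Icc_of_mem_subtree {n : ℕ} {T : RecursiveTree n} {a b : ℕ}
    (ha : a ∈ Finset.Icc 2 n) (h : b ∈ T.subtree a) : b ∈ Finset.Icc 2 n := by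
  change Relation.ReflTransGen T.IsChild a b at h
  cases h with
  | refl => exact ha
  | tail _ h => exact (isChild_iff.1 h).1

theorem subtree_finite {n : ℕ} (T : RecursiveTree n) {a : ℕ} (ha : a ∈ Finset.Icc 2 n) :
    (T.subtree a).Finite :=
  (Finset.finite_toSet (Finset.Icc 2 n)).subset fun _ hb => mem_Icc_of_mem_subtree ha hb

open Classical in
/-- The children of the root. -/
noncomputable def rootChildren {n : ℕ} (T : RecursiveTree n) : Finset ℕ :=
  (Finset.Icc 2 n).filter (T.IsChild 1)

theorem mem_rootChildren {n : ℕ} {T : RecursiveTree n} {c : ℕ} :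
    c ∈ T.rootChildren ↔ T.IsChild 1 c := by
  classical
  rw [rootChildren, Finset.mem_filter, and_iff_right_iff_imp]
  exact fun h => (isChild_iff.1 h).1

/-- The sizes of the branches. -/
noncomputable def branchSizes {n : ℕ} (T : RecursiveTree n) : Multiset ℕ :=
  T.rootChildren.val.map fun c => (T.subtree c).ncard

theorem exists_rootChild {n : ℕ} (T : RecursiveTree n) {i : ℕ} (hi : i ∈ Finset.Icc 2 n) :
    ∃ c ∈ T.rootChildren, i ∈ T.subtree c := by
  induction i using Nat.strong_induction_on with
  | _ i ih =>
    have hp := Finset.mem_Ico.1 (T.parent_mem hi)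
    have hi' := Finset.mem_Icc.1 hi
    have hc : T.IsChild (T.parent i) i := isChild_iff.2 ⟨hi, rfl⟩
    by_cases h1 : T.parent i = 1
    · exact ⟨i, mem_rootChildren.2 (h1 ▸ hc), Relation.ReflTransGen.refl⟩
    · obtain ⟨c, hcr, hcs⟩ := ih _ hp.2 (Finset.mem_Icc.2 ⟨by omega, by omega⟩)
      exact ⟨c, hcr, Relation.ReflTransGen.tail hcs hc⟩

/-- A proper descendant of `c` has a parent that is at least `c > 1`, whereas the parent of `d` is
`1`. -/
theorem eq_of_subtree_rootChild {n : ℕ} {T : RecursiveTree n} {c d : ℕ} (hc : c ∈ T.rootChildren)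
    (hd : d ∈ T.rootChildren) (h : d ∈ T.subtree c) : c = d := by
  change Relation.ReflTransGen T.IsChild c d at h
  rw [mem_rootChildren] at hc hd
  cases h with
  | refl => rfl
  | @tail b _ hb h =>
    have h1 : b = 1 := by rw [← (isChild_iff.1 h).2, (isChild_iff.1 hd).2]
    have := le_of_mem_subtree (T := T) hb
    have := hc.lt
    omega

/-- Parents are unique, so the ancestors of `i` form a chain; two root children on it are
comparable, hence equal. -/
theorem rootChild_unique {n : ℕ} {T : RecursiveTree n} {c d i : ℕ} (hc : c ∈ T.rootChildren)
    (hd : d ∈ T.rootChildren) (hic : i ∈ T.subtree c) (hid : i ∈ T.subtree d) : c = d := by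
  have hU : Relator.RightUnique (Function.swap T.IsChild) := by
    intro a b c hab hac
    rw [← (isChild_iff.1 hab).2, ← (isChild_iff.1 hac).2]
  have h1 : Relation.ReflTransGen (Function.swap T.IsChild) i c :=
    Relation.ReflTransGen.swap _ _ hic
  have h2 : Relation.ReflTransGen (Function.swap T.IsChild) i d :=
    Relation.ReflTransGen.swap _ _ hid
  rcases Relation.ReflTransGen.total_of_right_unique hU h1 h2 with h | h
  · exact (eq_of_subtree_rootChild hd hc (Relation.ReflTransGen.swap _ _ h)).symm
  · exact eq_of_subtree_rootChild hc hd (Relation.ReflTransGen.swap _ _ h)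

/-- Attach the new node `n + 1` to the node `i`. -/
def attach {n : ℕ} (T : RecursiveTree n) (i : Finset.Ico 1 (n + 1)) : RecursiveTree (n + 1) :=
  fun j => if h : (j : ℕ) ≤ n then T ⟨j, Finset.mem_Icc.2 ⟨(Finset.mem_Icc.1 j.2).1, h⟩⟩
    else ⟨i, Finset.mem_Ico.2 ⟨(Finset.mem_Ico.1 i.2).1, by
      have := (Finset.mem_Ico.1 i.2).2; omega⟩⟩

/-- A recursive tree on `n + 1` nodes is a recursive tree on `n` nodes with a new node attached. -/
def attachEquiv {n : ℕ} (hn : 1 ≤ n) :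
    RecursiveTree n × Finset.Ico 1 (n + 1) ≃ RecursiveTree (n + 1) where
  toFun p := p.1.attach p.2
  invFun T := (fun j => T ⟨j, Finset.mem_Icc.2 ⟨(Finset.mem_Icc.1 j.2).1,
    (Finset.mem_Icc.1 j.2).2.trans n.le_succ⟩⟩,
    T ⟨n + 1, Finset.mem_Icc.2 ⟨by omega, le_rfl⟩⟩)
  left_inv p := by
    refine Prod.ext (funext fun j => ?_) ?_
    · exact dif_pos (Finset.mem_Icc.1 j.2).2
    · exact dif_neg (Nat.not_succ_le_self n)
  right_inv T := by
    funext j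
    by_cases h : (j : ℕ) ≤ n
    · exact dif_pos h
    · have hj : j = ⟨n + 1, Finset.mem_Icc.2 ⟨by omega, le_rfl⟩⟩ :=
        Subtype.ext (by have := (Finset.mem_Icc.1 j.2).2; simp; omega)
      rw [hj]
      exact dif_neg (Nat.not_succ_le_self n)

theorem parent_attach_of_le {n : ℕ} (T : RecursiveTree n) (i : Finset.Ico 1 (n + 1)) {j : ℕ}
    (hj : j ≤ n) : (T.attach i).parent j = T.parent j := by
  unfold parent
  by_cases h2 : 2 ≤ j
  · rw [dif_pos (Finset.mem_Icc.2 ⟨h2, hj.trans n.le_succ⟩), dif_pos (Finset.mem_Icc.2 ⟨h2, hj⟩)]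
    exact congrArg Subtype.val (dif_pos hj)
  · rw [dif_neg fun h => h2 (Finset.mem_Icc.1 h).1, dif_neg fun h => h2 (Finset.mem_Icc.1 h).1]

theorem parent_attach_last {n : ℕ} (hn : 1 ≤ n) (T : RecursiveTree n) (i : Finset.Ico 1 (n + 1)) :
    (T.attach i).parent (n + 1) = i := by
  unfold parent
  rw [dif_pos (Finset.mem_Icc.2 ⟨by omega, le_rfl⟩)]
  exact congrArg Subtype.val (dif_neg (Nat.not_succ_le_self n))

theorem isChild_attach_of_le {n : ℕ} {T : RecursiveTree n} {i : Finset.Ico 1 (n + 1)} {a b : ℕ}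
    (hb : b ≤ n) : (T.attach i).IsChild a b ↔ T.IsChild a b := by
  rw [isChild_iff, isChild_iff, parent_attach_of_le T i hb, Finset.mem_Icc, Finset.mem_Icc]
  have : b ≤ n + 1 := hb.trans n.le_succ
  tauto

theorem isChild_attach_last {n : ℕ} (hn : 1 ≤ n) {T : RecursiveTree n}
    {i : Finset.Ico 1 (n + 1)} {a : ℕ} : (T.attach i).IsChild a (n + 1) ↔ a = i := by
  rw [isChild_iff, parent_attach_last hn, Finset.mem_Icc]
  constructor
  · exact fun h => h.2.symm
  · exact fun h => ⟨⟨by omega, le_rfl⟩, h.symm⟩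

theorem mem_subtree_attach_of_le {n : ℕ} {T : RecursiveTree n} {i : Finset.Ico 1 (n + 1)}
    {a b : ℕ} (hb : b ≤ n) : b ∈ (T.attach i).subtree a ↔ b ∈ T.subtree a := by
  change Relation.ReflTransGen _ a b ↔ Relation.ReflTransGen _ a b
  constructor
  · intro h
    induction h with
    | refl => exact Relation.ReflTransGen.refl
    | tail _ h ih => exact (ih (h.lt.le.trans hb)).tail ((isChild_attach_of_le hb).1 h)
  · exact fun h => Relation.ReflTransGen.mono (fun x y hxy =>
      (isChild_attach_of_le (Finset.mem_Icc.1 (isChild_iff.1 hxy).1).2).2 hxy) _ _ h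

theorem last_mem_subtree_attach {n : ℕ} (hn : 1 ≤ n) {T : RecursiveTree n}
    {i : Finset.Ico 1 (n + 1)} {a : ℕ} (ha : a ≤ n) :
    n + 1 ∈ (T.attach i).subtree a ↔ (i : ℕ) ∈ T.subtree a := by
  have hi : (i : ℕ) ≤ n := Nat.lt_succ_iff.1 (Finset.mem_Ico.1 i.2).2
  rw [← mem_subtree_attach_of_le (i := i) hi]
  constructor
  · intro h
    rcases Relation.ReflTransGen.cases_tail h with h | ⟨b, hb, hc⟩
    · omega
    · rw [isChild_attach_last hn] at hc
      exact hc ▸ hb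
  · exact fun h => Relation.ReflTransGen.tail h ((isChild_attach_last hn).2 rfl)

theorem subtree_attach_last {n : ℕ} (T : RecursiveTree n) (i : Finset.Ico 1 (n + 1)) :
    (T.attach i).subtree (n + 1) = {n + 1} := by
  ext b
  constructor
  · intro h
    have h1 := le_of_mem_subtree h
    rcases Relation.ReflTransGen.cases_tail h with h | ⟨a, -, hc⟩
    · exact h
    · exact le_antisymm (Finset.mem_Icc.1 (isChild_iff.1 hc).1).2 h1
  · rintro rfl
    exact Relation.ReflTransGen.refl

theorem le_of_mem_subtree_attach {n : ℕ} {T : RecursiveTree n} {i : Finset.Ico 1 (n + 1)} {a b : ℕ}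
    (ha : a ≤ n) (hb : b ∈ (T.attach i).subtree a) : b ≤ n + 1 := by
  rcases Relation.ReflTransGen.cases_tail hb with h | ⟨_, -, hc⟩
  · omega
  · exact (Finset.mem_Icc.1 (isChild_iff.1 hc).1).2

theorem ncard_subtree_attach_of_mem {n : ℕ} {T : RecursiveTree n}
    {i : Finset.Ico 1 (n + 1)} {a : ℕ} (ha : a ∈ Finset.Icc 2 n) (h : (i : ℕ) ∈ T.subtree a) :
    ((T.attach i).subtree a).ncard = (T.subtree a).ncard + 1 := by
  have ha' := Finset.mem_Icc.1 ha
  have hs : (T.attach i).subtree a = insert (n + 1) (T.subtree a) := by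
    ext b
    by_cases hb : b ≤ n
    · rw [mem_subtree_attach_of_le hb, Set.mem_insert_iff, or_iff_right (by omega)]
    · rcases eq_or_ne b (n + 1) with rfl | hb'
      · simp [last_mem_subtree_attach (by omega : 1 ≤ n) ha'.2, h]
      · constructor
        · intro hb2
          have := le_of_mem_subtree_attach ha'.2 hb2
          omega
        · rintro (hb2 | hb2)
          · omega
          · have := (Finset.mem_Icc.1 (mem_Icc_of_mem_subtree ha hb2)).2
            omega
  rw [hs, Set.ncard_insert_of_notMem _ (T.subtree_finite ha)]
  intro h'
  have := (Finset.mem_Icc.1 (mem_Icc_of_mem_subtree ha h')).2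
  omega

theorem subtree_attach_of_notMem {n : ℕ} {T : RecursiveTree n}
    {i : Finset.Ico 1 (n + 1)} {a : ℕ} (ha : a ∈ Finset.Icc 2 n) (h : (i : ℕ) ∉ T.subtree a) :
    (T.attach i).subtree a = T.subtree a := by
  have ha' := Finset.mem_Icc.1 ha
  ext b
  by_cases hb : b ≤ n
  · rw [mem_subtree_attach_of_le hb]
  · constructor
    · intro hb2
      have := le_of_mem_subtree_attach ha'.2 hb2
      have hb3 : b = n + 1 := by omega
      subst hb3
      exact absurd ((last_mem_subtree_attach (by omega : 1 ≤ n) ha'.2).1 hb2) h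
    · intro hb2
      have := (Finset.mem_Icc.1 (mem_Icc_of_mem_subtree ha hb2)).2
      omega

theorem rootChildren_attach_root {n : ℕ} (hn : 1 ≤ n) (T : RecursiveTree n)
    {i : Finset.Ico 1 (n + 1)} (hi : (i : ℕ) = 1) :
    (T.attach i).rootChildren = insert (n + 1) T.rootChildren := by
  ext b
  rw [Finset.mem_insert, mem_rootChildren, mem_rootChildren]
  by_cases hb : b ≤ n
  · rw [isChild_attach_of_le hb, or_iff_right (by omega)]
  · constructor
    · intro h
      have := (Finset.mem_Icc.1 (isChild_iff.1 h).1).2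
      exact Or.inl (by omega)
    · rintro (rfl | h)
      · exact (isChild_attach_last hn).2 hi.symm
      · have := (Finset.mem_Icc.1 (isChild_iff.1 h).1).2
        omega

theorem rootChildren_attach_of_ne {n : ℕ} (hn : 1 ≤ n) (T : RecursiveTree n)
    {i : Finset.Ico 1 (n + 1)} (hi : (i : ℕ) ≠ 1) :
    (T.attach i).rootChildren = T.rootChildren := by
  ext b
  rw [mem_rootChildren, mem_rootChildren]
  by_cases hb : b ≤ n
  · rw [isChild_attach_of_le hb]
  · constructor
    · intro h
      have := (Finset.mem_Icc.1 (isChild_iff.1 h).1).2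
      have hb3 : b = n + 1 := by omega
      subst hb3
      exact absurd ((isChild_attach_last hn).1 h).symm hi
    · intro h
      have := (Finset.mem_Icc.1 (isChild_iff.1 h).1).2
      omega

theorem rootChildren_subset {n : ℕ} (T : RecursiveTree n) : T.rootChildren ⊆ Finset.Icc 2 n :=
  fun _ hc => (isChild_iff.1 (mem_rootChildren.1 hc)).1

theorem branchSizes_attach_root {n : ℕ} (hn : 1 ≤ n) (T : RecursiveTree n)
    {i : Finset.Ico 1 (n + 1)} (hi : (i : ℕ) = 1) :
    (T.attach i).branchSizes = 1 ::ₘ T.branchSizes := by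
  have hnot : n + 1 ∉ T.rootChildren := fun h => by
    have := (Finset.mem_Icc.1 (T.rootChildren_subset h)).2
    omega
  unfold branchSizes
  rw [rootChildren_attach_root hn T hi, Finset.insert_val_of_notMem hnot, Multiset.map_cons,
    subtree_attach_last, Set.ncard_singleton]
  congr 1
  refine Multiset.map_congr rfl fun c hc => ?_
  have hc' := T.rootChildren_subset hc
  rw [subtree_attach_of_notMem hc']
  intro h
  have := le_of_mem_subtree h
  have := (Finset.mem_Icc.1 hc').1
  omega

theorem branchSizes_attach_of_mem {n : ℕ} (hn : 1 ≤ n) (T : RecursiveTree n)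
    {i : Finset.Ico 1 (n + 1)} {c : ℕ} (hc : c ∈ T.rootChildren) (hi : (i : ℕ) ∈ T.subtree c) :
    (T.attach i).branchSizes =
      ((T.subtree c).ncard + 1) ::ₘ T.branchSizes.erase (T.subtree c).ncard := by
  have hc2 := T.rootChildren_subset hc
  have hi1 : (i : ℕ) ≠ 1 := by
    have := le_of_mem_subtree hi
    have := (Finset.mem_Icc.1 hc2).1
    omega
  unfold branchSizes
  have hval : T.rootChildren.val = c ::ₘ (T.rootChildren.erase c).val := by
    rw [Finset.erase_val, Multiset.cons_erase hc]
  rw [rootChildren_attach_of_ne hn T hi1, hval, Multiset.map_cons, Multiset.map_cons,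
    Multiset.erase_cons_head, ncard_subtree_attach_of_mem hc2 hi]
  congr 1
  refine Multiset.map_congr rfl fun d hd => ?_
  obtain ⟨hdc, hd⟩ := Finset.mem_erase.1 (Finset.mem_def.2 hd)
  rw [subtree_attach_of_notMem (T.rootChildren_subset hd)]
  exact fun h => hdc (rootChild_unique hd hc h hi)

/-- The branches partition the non-root nodes. -/
theorem sum_rootChildren {n : ℕ} (T : RecursiveTree n) (F : ℕ → ℝ) (G : ℕ → ℝ)
    (hFG : ∀ c ∈ T.rootChildren, ∀ i ∈ T.subtree c, F i = G c) :
    ∑ i ∈ Finset.Icc 2 n, F i = ∑ c ∈ T.rootChildren, (T.subtree c).ncard * G c := by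
  classical
  have hU : Finset.Icc 2 n =
      T.rootChildren.biUnion fun c => (Finset.Icc 2 n).filter (· ∈ T.subtree c) := by
    ext i
    simp only [Finset.mem_biUnion, Finset.mem_filter]
    constructor
    · intro hi
      obtain ⟨c, hc, hic⟩ := T.exists_rootChild hi
      exact ⟨c, hc, hi, hic⟩
    · rintro ⟨c, -, hi, -⟩
      exact hi
  conv_lhs => rw [hU]
  rw [Finset.sum_biUnion]
  · refine Finset.sum_congr rfl fun c hc => ?_
    rw [Finset.sum_congr rfl fun i hi => hFG c hc i (Finset.mem_filter.1 hi).2, Finset.sum_const,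
      nsmul_eq_mul]
    congr 2
    rw [← Set.ncard_coe_finset]
    congr 1
    ext i
    simp only [Finset.coe_filter, Set.mem_ofPred_eq, and_iff_right_iff_imp]
    exact mem_Icc_of_mem_subtree (T.rootChildren_subset hc)
  · intro c hc d hd hcd
    refine Finset.disjoint_left.2 fun i hi hi' => hcd ?_
    exact rootChild_unique hc hd (Finset.mem_filter.1 hi).2 (Finset.mem_filter.1 hi').2

theorem hoppeWeight_eq {n : ℕ} (θ : ℝ) (T : RecursiveTree n) :
    hoppeWeight θ T =
      ∏ j ∈ Finset.Icc 2 n, (if T.parent j = 1 then θ else 1) / (θ + (j : ℕ) - 2) := by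
  unfold hoppeWeight
  rw [← Finset.prod_coe_sort (Finset.Icc 2 n)]
  refine Finset.prod_congr rfl fun j _ => ?_
  rw [parent, dif_pos j.2]

theorem hoppeWeight_attach {n : ℕ} (hn : 1 ≤ n) (θ : ℝ) (T : RecursiveTree n)
    (i : Finset.Ico 1 (n + 1)) :
    hoppeWeight θ (T.attach i) =
      hoppeWeight θ T * ((if (i : ℕ) = 1 then θ else 1) / (θ + n - 1)) := by
  rw [hoppeWeight_eq, hoppeWeight_eq, Finset.prod_Icc_succ_top (by omega), parent_attach_last hn]
  congr 1
  · refine Finset.prod_congr rfl fun j hj => ?_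
    rw [parent_attach_of_le T i (Finset.mem_Icc.1 hj).2]
  · push_cast
    ring

/-- Attaching to the root creates a block of size `1` with weight `θ`; a branch of size `s` offers
`s` places, each turning it into a branch of size `s + 1`. -/
theorem sum_attach {n : ℕ} (hn : 1 ≤ n) (θ : ℝ) (T : RecursiveTree n) (f : Multiset ℕ → ℝ) :
    ∑ i : Finset.Ico 1 (n + 1), (if (i : ℕ) = 1 then θ else 1) * f (T.attach i).branchSizes =
      growth θ f T.branchSizes := by
  classical
  have h1 : 1 ∈ Finset.Ico 1 (n + 1) := Finset.mem_Ico.2 ⟨le_rfl, by omega⟩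
  set F : ℕ → ℝ := fun i => if h : i ∈ Finset.Ico 1 (n + 1) then
    (if i = 1 then θ else 1) * f (T.attach ⟨i, h⟩).branchSizes else 0 with hF
  have e : ∑ i : Finset.Ico 1 (n + 1), (if (i : ℕ) = 1 then θ else 1) *
      f (T.attach i).branchSizes = ∑ i ∈ Finset.Ico 1 (n + 1), F i := by
    rw [← Finset.sum_coe_sort (Finset.Ico 1 (n + 1))]
    refine Finset.sum_congr rfl fun i _ => ?_
    rw [hF]
    simp only [dif_pos i.2]
  have e2 : Finset.Ico (1 + 1) (n + 1) = Finset.Icc 2 n := by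
    ext; simp only [Finset.mem_Ico, Finset.mem_Icc]; omega
  rw [e, Finset.sum_eq_sum_Ico_succ_bot (by omega), e2, T.sum_rootChildren F
    fun c => f (((T.subtree c).ncard + 1) ::ₘ T.branchSizes.erase (T.subtree c).ncard)]
  · unfold growth
    congr 1
    · simp only [hF, dif_pos h1, if_true]
      rw [branchSizes_attach_root hn T rfl]
    · conv_rhs => rw [branchSizes, Multiset.map_map]
      rfl
  · intro c hc i hi
    have hi2 := Finset.mem_Icc.1 (mem_Icc_of_mem_subtree (T.rootChildren_subset hc) hi)
    have him : i ∈ Finset.Ico 1 (n + 1) := Finset.mem_Ico.2 ⟨by omega, by omega⟩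
    simp only [hF, dif_pos him]
    rw [if_neg (by omega), one_mul, branchSizes_attach_of_mem hn T hc hi]

/-- The branch sizes of the Hoppe tree follow the Chinese restaurant process. -/
theorem sum_hoppeWeight_mul {θ : ℝ} (hθ : 0 < θ) (m : ℕ) (f : Multiset ℕ → ℝ) :
    ∑ T : RecursiveTree (m + 1), hoppeWeight θ T * f T.branchSizes = crp θ m f / crpMass θ m := by
  induction m generalizing f with
  | zero =>
    have hE : IsEmpty (Finset.Icc 2 (0 + 1)) := ⟨fun j => by
      have := Finset.mem_Icc.1 j.2; omega⟩
    have : Unique (RecursiveTree (0 + 1)) := Pi.uniqueOfIsEmpty _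
    have hb : ∀ T : RecursiveTree (0 + 1), T.branchSizes = 0 := by
      intro T
      have : T.rootChildren = ∅ := Finset.subset_empty.1 T.rootChildren_subset
      simp [branchSizes, this]
    have := sum_hoppeWeight hθ (0 + 1)
    simp only [hb, ← Finset.sum_mul, this, crpMass_zero, crp]
    simp
  | succ m ih =>
    rw [← Equiv.sum_comp (attachEquiv (by omega : 1 ≤ m + 1)), Fintype.sum_prod_type]
    have hθm : θ + m ≠ 0 := by positivity
    have hm := (crpMass_pos hθ m).ne'
    have e : ∀ T : RecursiveTree (m + 1),
        ∑ i : Finset.Ico 1 (m + 1 + 1), hoppeWeight θ (attachEquiv (by omega) (T, i)) *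
          f (attachEquiv (by omega) (T, i)).branchSizes =
        (θ + m)⁻¹ * (hoppeWeight θ T * growth θ f T.branchSizes) := by
      intro T
      rw [← sum_attach (by omega), Finset.mul_sum, Finset.mul_sum]
      refine Finset.sum_congr rfl fun i _ => ?_
      change hoppeWeight θ (T.attach i) * f (T.attach i).branchSizes = _
      rw [hoppeWeight_attach (by omega)]
      push_cast
      rw [show θ + ((m : ℝ) + 1) - 1 = θ + m by ring]
      ring
    rw [Finset.sum_congr rfl fun T _ => e T, ← Finset.mul_sum, ih, crpMass_succ]
    simp only [crp]
    field_simp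

/-- The hypothesis `0 ≤ t` covers the tree without branches, where the supremum of the empty set is
`0`. -/
theorem largestBranch_le_iff {n : ℕ} (T : RecursiveTree n) {t : ℝ} (ht : 0 ≤ t) :
    (T.largestBranch : ℝ) ≤ t ↔ ∀ s ∈ T.branchSizes, (s : ℝ) ≤ t := by
  have hmem : ∀ s, s ∈ T.branchSizes ↔ s ∈ Finset.Icc 1 (n - 1) ∧ 1 ≤ T.numBranches s := by
    intro s
    have hfin : {i : ℕ | T.IsChild 1 i ∧ (T.subtree i).ncard = s}.Finite :=
      (Finset.finite_toSet T.rootChildren).subset fun i hi => mem_rootChildren.2 hi.1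
    rw [numBranches, Nat.one_le_iff_ne_zero, Ne, Set.ncard_eq_zero hfin, ← Ne,
      ← Set.nonempty_iff_ne_empty]
    unfold branchSizes
    rw [Multiset.mem_map]
    constructor
    · rintro ⟨c, hc, rfl⟩
      have hc2 := T.rootChildren_subset hc
      refine ⟨Finset.mem_Icc.2 ⟨?_, ?_⟩, c, mem_rootChildren.1 hc, rfl⟩
      · exact (Set.ncard_pos (T.subtree_finite hc2)).2 ⟨c, Relation.ReflTransGen.refl⟩
      · have h := Set.ncard_le_ncard (s := T.subtree c) (t := (Finset.Icc 2 n : Finset ℕ))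
          (fun b hb => mem_Icc_of_mem_subtree hc2 hb) (Finset.finite_toSet _)
        rw [Set.ncard_coe_finset, Nat.card_Icc] at h
        omega
    · rintro ⟨-, c, hc, rfl⟩
      exact ⟨c, mem_rootChildren.2 hc, rfl⟩
  unfold largestBranch
  simp only [← hmem]
  have hb : BddAbove {s : ℕ | s ∈ T.branchSizes} :=
    ⟨n - 1, fun s hs => (Finset.mem_Icc.1 ((hmem s).1 hs).1).2⟩
  constructor
  · intro h s hs
    exact le_trans (by exact_mod_cast le_csSup hb hs) h
  · intro h
    rcases Set.eq_empty_or_nonempty {s : ℕ | s ∈ T.branchSizes} with he | hne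
    · rw [he]; simpa using ht
    · exact h _ (Nat.sSup_mem hne hb)

end RecursiveTree

/-! ### Factorial moments of the number of large blocks -/

/-- The number of blocks larger than `t`. -/
noncomputable def countGt (t : ℝ) (l : Multiset ℕ) : ℕ := l.countP fun s : ℕ => t < s

theorem countGt_cons (t : ℝ) (s : ℕ) (l : Multiset ℕ) :
    countGt t (s ::ₘ l) = countGt t l + if t < s then 1 else 0 := by
  unfold countGt
  rw [Multiset.countP_cons]

theorem countGt_eq_zero_iff {t : ℝ} {l : Multiset ℕ} :
    countGt t l = 0 ↔ ∀ s ∈ l, (s : ℝ) ≤ t := by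
  simp [countGt, Multiset.countP_eq_zero]

theorem countGt_mul_le (t : ℝ) (l : Multiset ℕ) : countGt t l * t ≤ l.sum := by
  induction l using Multiset.induction_on with
  | empty => simp [countGt]
  | cons s l ih =>
    rw [countGt_cons, Multiset.sum_cons, Nat.cast_add, Nat.cast_add]
    split_ifs with h
    · push_cast at *
      linarith
    · have : (0 : ℝ) ≤ s := s.cast_nonneg
      push_cast at *
      linarith

/-- `k`-th factorial moments of the number of blocks larger than `t`, normalised as `crp`. -/
noncomputable def blockMoment (θ t : ℝ) : ℕ → ℕ → ℝ
  | 0, m => crpMass θ m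
  | k + 1, m => ∑ p ∈ Finset.HasAntidiagonal.antidiagonal m,
      (if t < p.1 then θ / p.1 else 0) * blockMoment θ t k p.2

theorem blockMoment_nonneg {θ : ℝ} (hθ : 0 < θ) (t : ℝ) (k m : ℕ) : 0 ≤ blockMoment θ t k m := by
  induction k generalizing m with
  | zero => exact (crpMass_pos hθ m).le
  | succ k ih =>
    refine Finset.sum_nonneg fun p _ => mul_nonneg ?_ (ih _)
    split_ifs <;> positivity

/-- With `N` large blocks, the marked one is chosen in `N` ways and its removal leaves `N - 1`. -/
theorem palmSum_descFactorial (t : ℝ) (k : ℕ) (l : Multiset ℕ) :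
    palmSum (fun s => if t < s then 1 else 0) (fun l => ((countGt t l).descFactorial k : ℝ)) l =
      ((countGt t l).descFactorial (k + 1) : ℝ) := by
  have h1 : ∀ s ∈ l, (if t < (s : ℝ) then (1 : ℝ) else 0) *
      ((countGt t (l.erase s)).descFactorial k : ℝ) =
      (if t < (s : ℝ) then (1 : ℝ) else 0) * ((countGt t l - 1).descFactorial k : ℝ) := by
    intro s hs
    split_ifs with h
    · have := countGt_cons t s (l.erase s)
      rw [Multiset.cons_erase hs, if_pos h] at this
      rw [this, Nat.add_sub_cancel]
    · simp
  have h2 : (l.map fun s : ℕ => if t < (s : ℝ) then (1 : ℝ) else 0).sum = countGt t l := by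
    induction l using Multiset.induction_on with
    | empty => simp [countGt]
    | cons s l ih =>
      rw [countGt_cons, Multiset.map_cons, Multiset.sum_cons, ih]
      · push_cast; ring
      · intro s hs
        split_ifs with h
        · have := countGt_cons t s (l.erase s)
          rw [Multiset.cons_erase hs, if_pos h] at this
          rw [this, Nat.add_sub_cancel]
        · simp
  unfold palmSum
  rw [Multiset.map_congr rfl h1, Multiset.sum_map_mul_right, h2]
  cases countGt t l with
  | zero => simp
  | succ N => rw [Nat.succ_descFactorial_succ]; push_cast; simp

theorem crp_descFactorial (θ t : ℝ) (k m : ℕ) :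
    crp θ m (fun l => ((countGt t l).descFactorial k : ℝ)) = blockMoment θ t k m := by
  induction k generalizing m with
  | zero => simp [blockMoment, crpMass]
  | succ k ih =>
    rw [← funext (palmSum_descFactorial t k), crp_palmSum, blockMoment]
    refine Finset.sum_congr rfl fun p _ => ?_
    rw [ih]
    split_ifs <;> ring

theorem crp_sum {ι : Type*} (θ : ℝ) (m : ℕ) (s : Finset ι) (f : ι → Multiset ℕ → ℝ) :
    crp θ m (fun l => ∑ i ∈ s, f i l) = ∑ i ∈ s, crp θ m (f i) := by
  classical
  induction s using Finset.induction_on with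
  | empty =>
    have := crp_const_mul θ m 0 fun _ => 0
    simpa using this
  | insert i s hi ih => simp only [Finset.sum_insert hi, crp_add, ih]

/-- This is the expansion of `(1 - 1) ^ N`; the terms with `k > N` are zero. -/
theorem sum_neg_one_pow_descFactorial {N K : ℕ} (h : N < K) :
    ∑ k ∈ Finset.range K, (-1 : ℝ) ^ k / k ! * N.descFactorial k = if N = 0 then 1 else 0 := by
  have h1 : ∀ k : ℕ, (-1 : ℝ) ^ k / k ! * N.descFactorial k = (-1) ^ k * (N.choose k : ℝ) := by
    intro k
    rw [Nat.descFactorial_eq_factorial_mul_choose]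
    push_cast
    field_simp
  rw [Finset.sum_congr rfl fun k _ => h1 k, ← Finset.sum_subset
    (Finset.range_subset_range.2 (Nat.succ_le_of_lt h)) fun k _ hk => by
      rw [Nat.choose_eq_zero_of_lt (by simpa using hk)]; simp]
  exact_mod_cast Int.alternating_sum_range_choose

/-- Inclusion-exclusion for the event that no block is larger than `t`. -/
theorem crp_forall_le {θ t : ℝ} (ht : 0 ≤ t) {m K : ℕ} (hK : (m : ℝ) < K * t) :
    crp θ m (fun l => if ∀ s ∈ l, (s : ℝ) ≤ t then 1 else 0) =
      ∑ k ∈ Finset.range K, (-1 : ℝ) ^ k / k ! * blockMoment θ t k m := by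
  simp only [← crp_descFactorial, ← crp_const_mul, ← crp_sum]
  refine crp_congr fun l hl => ?_
  have h := countGt_mul_le t l
  rw [hl] at h
  have hN : countGt t l < K := by
    by_contra hc
    have : (K : ℝ) ≤ countGt t l := by exact_mod_cast not_lt.1 hc
    nlinarith
  rw [sum_neg_one_pow_descFactorial hN]
  simp only [countGt_eq_zero_iff]

/-- When all blocks are at most `t`, the total `m` equals the sum of the block sizes that are at
most `t`. Dropping the event elsewhere leaves a Palm sum, in which the factor `s` cancels the
denominator of `θ / s`. -/
theorem mul_crp_forall_le_le {θ t : ℝ} (hθ : 0 < θ) (m : ℕ) :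
    m * crp θ m (fun l => if ∀ s ∈ l, (s : ℝ) ≤ t then 1 else 0) ≤
      ∑ p ∈ Finset.HasAntidiagonal.antidiagonal m,
        (if p.1 ≠ 0 ∧ (p.1 : ℝ) ≤ t then θ else 0) * crpMass θ p.2 := by
  have h1 : ∑ p ∈ Finset.HasAntidiagonal.antidiagonal m,
        (if p.1 ≠ 0 ∧ (p.1 : ℝ) ≤ t then θ else 0) * crpMass θ p.2 =
      crp θ m (palmSum (fun s => if (s : ℝ) ≤ t then (s : ℝ) else 0) fun _ => 1) := by
    rw [crp_palmSum]
    refine Finset.sum_congr rfl fun p _ => ?_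
    unfold crpMass
    congr 1
    rcases eq_or_ne p.1 0 with h | h
    · simp [h]
    · by_cases h2 : (p.1 : ℝ) ≤ t
      · simp only [h, h2, ne_eq, not_false_eq_true, and_self, if_true]
        field_simp
      · simp [h2]
  rw [h1, ← crp_const_mul]
  refine crp_mono hθ fun l hl => ?_
  have h0 : ∀ s : ℕ, (0 : ℝ) ≤ if (s : ℝ) ≤ t then (s : ℝ) else 0 := by
    intro s; split_ifs <;> positivity
  unfold palmSum
  simp only [mul_one]
  split_ifs with h
  · rw [Multiset.map_congr rfl fun s hs => if_pos (h s hs), ← hl, Nat.cast_multiset_sum, mul_one]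
  · rw [mul_zero]
    exact Multiset.sum_nonneg fun a ha => by
      obtain ⟨s, -, rfl⟩ := Multiset.mem_map.1 ha
      exact h0 s

theorem crpMass_one (m : ℕ) : crpMass 1 m = 1 := by
  induction m with
  | zero => rfl
  | succ m ih => rw [crpMass_succ, ih]; field_simp; ring

/-- In the Palm formula `s ^ 2` is weighted by `1 / s`, and all total weights are `1`, so the sum is
`0 + 1 + ⋯ + m`. -/
theorem crp_sum_sq (m : ℕ) :
    crp 1 m (fun l => (l.map fun s : ℕ => (s : ℝ) ^ 2).sum) = m * (m + 1) / 2 := by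
  have h1 : (fun l : Multiset ℕ => (l.map fun s : ℕ => (s : ℝ) ^ 2).sum) =
      palmSum (fun s => (s : ℝ) ^ 2) fun _ => 1 := by
    funext l; simp [palmSum]
  rw [h1, crp_palmSum, Finset.Nat.sum_antidiagonal_eq_sum_range_succ_mk]
  have h2 : ∀ k : ℕ, (1 : ℝ) / k * (k : ℝ) ^ 2 * crp 1 (m - k) (fun _ => 1) = k := by
    intro k
    have := crpMass_one (m - k)
    unfold crpMass at this
    rw [this]
    rcases eq_or_ne k 0 with rfl | hk
    · simp
    · field_simp
  simp only [h2]
  rw [← Nat.cast_sum, Finset.sum_range_succ_comm]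
  have := Finset.sum_range_id_mul_two (m + 1)
  rw [Finset.sum_range_succ_comm] at this
  have h3 : ((m + ∑ x ∈ Finset.range m, x : ℕ) : ℝ) * 2 = (m + 1) * m := by
    exact_mod_cast this
  linarith

/-! ### Asymptotics of the total weights -/

/-- The total weights are asymptotically `m ^ (θ - 1) / Γ(θ)`. -/
theorem tendsto_crpMass {θ : ℝ} (hθ : 0 < θ) :
    Tendsto (fun m : ℕ => ((m : ℝ) + 1) ^ (1 - θ) * crpMass θ m) atTop (𝓝 (Real.Gamma θ)⁻¹) := by
  have hprod : ∀ m : ℕ, crpMass θ m * m ! = ∏ j ∈ Finset.range m, (θ + j) := by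
    intro m
    induction m with
    | zero => simp [crpMass_zero]
    | succ m ih =>
      rw [Finset.prod_range_succ, ← ih, crpMass_succ, Nat.factorial_succ]
      push_cast
      field_simp
  -- Euler's limit formula. The product in `Real.GammaSeq` has the additional factor `θ + m` and
  -- uses powers of `m` instead of `m + 1`; `hr` and `hs` correct for this.
  have hG := (Real.GammaSeq_tendsto_Gamma θ).inv₀ (Real.Gamma_pos_of_pos hθ).ne'
  have hr : Tendsto (fun m : ℕ => (m : ℝ) / (m + θ)) atTop (𝓝 1) :=
    tendsto_natCast_div_add_atTop θ
  have hs : Tendsto (fun m : ℕ => ((m : ℝ) / (m + 1)) ^ (θ - 1)) atTop (𝓝 1) := by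
    have := (tendsto_natCast_div_add_atTop (1 : ℝ)).rpow_const (p := θ - 1) (Or.inl one_ne_zero)
    simpa using this
  have := (hG.mul hr).mul hs
  rw [mul_one, mul_one] at this
  refine this.congr' ?_
  filter_upwards [eventually_gt_atTop 0] with m hm
  have hm' : (0 : ℝ) < m := by exact_mod_cast hm
  have hfac : (m ! : ℝ) ≠ 0 := by positivity
  have hq : crpMass θ m = (∏ j ∈ Finset.range m, (θ + j)) / m ! := by
    rw [← hprod]; field_simp
  have hP : ∏ j ∈ Finset.range m, (θ + j) ≠ 0 := by
    rw [← hprod]; exact mul_ne_zero (crpMass_pos hθ m).ne' hfac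
  rw [hq, Real.GammaSeq, Finset.prod_range_succ, Real.div_rpow hm'.le (by positivity),
    show (1 - θ) = -(θ - 1) by ring, Real.rpow_neg (by positivity), Real.rpow_sub_one hm'.ne']
  have h1 : (m : ℝ) ^ θ ≠ 0 := (Real.rpow_pos_of_pos hm' _).ne'
  have h2 : ((m : ℝ) + 1) ^ (θ - 1) ≠ 0 := (Real.rpow_pos_of_pos (by positivity) _).ne'
  have h3 : θ + m ≠ 0 := by positivity
  have h4 : (m : ℝ) + θ ≠ 0 := by positivity
  field_simp
  rw [add_comm]

theorem exists_crpMass_le {θ : ℝ} (hθ : 0 < θ) :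
    ∃ C : ℝ, 0 < C ∧ ∀ m : ℕ, crpMass θ m ≤ C * ((m : ℝ) + 1) ^ (θ - 1) := by
  obtain ⟨C, hC⟩ := (tendsto_crpMass hθ).bddAbove_range
  refine ⟨max C 1, by positivity, fun m => ?_⟩
  have h := hC (Set.mem_range_self m)
  have hp : 0 < ((m : ℝ) + 1) ^ (θ - 1) := Real.rpow_pos_of_pos (by positivity) _
  rw [show (1 - θ) = -(θ - 1) by ring, Real.rpow_neg (by positivity)] at h
  calc crpMass θ m = (((m : ℝ) + 1) ^ (θ - 1))⁻¹ * crpMass θ m * ((m : ℝ) + 1) ^ (θ - 1) := by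
        field_simp
    _ ≤ C * ((m : ℝ) + 1) ^ (θ - 1) := by gcongr
    _ ≤ _ := by gcongr; exact le_max_left _ _

/-! ### Scaling limits of the factorial moments -/

/-- The integrand is a step function with mesh `1 / n`. Sums become integrals over a fixed space, to
which dominated convergence applies. -/
theorem integral_comp_floor (g : ℕ → ℝ) {n : ℕ} (hn : 0 < n) (m : ℕ) :
    ∫ y in Set.Ioo (0 : ℝ) ((m : ℝ) / n), g ⌊n * y⌋₊ = (1 / n) * ∑ j ∈ Finset.range m, g j := by
  have hn' : (0 : ℝ) < n := by exact_mod_cast hn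
  have hfl : ∀ j : ℕ, ∀ y ∈ Set.Ioo ((j : ℝ) / n) (((j + 1 : ℕ) : ℝ) / n), g j = g ⌊n * y⌋₊ := by
    intro j y hy
    congr 1
    have h1 := (div_lt_iff₀ hn').1 hy.1
    have h2 := (lt_div_iff₀ hn').1 hy.2
    push_cast at h2
    refine ((Nat.floor_eq_iff ?_).2 ⟨?_, ?_⟩).symm <;> nlinarith [j.cast_nonneg (α := ℝ)]
  have hle : ∀ j : ℕ, (j : ℝ) / n ≤ ((j + 1 : ℕ) : ℝ) / n := by
    intro j; gcongr; exact j.le_succ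
  have hint : ∀ j : ℕ, IntervalIntegrable (fun y : ℝ => g ⌊n * y⌋₊) volume ((j : ℝ) / n)
      (((j + 1 : ℕ) : ℝ) / n) := by
    intro j
    rw [intervalIntegrable_iff_integrableOn_Ioo_of_le (hle j)]
    refine IntegrableOn.congr_fun (f := fun _ => g j) ?_ (hfl j) measurableSet_Ioo
    exact integrableOn_const (by simp) (by simp)
  have hval : ∀ j : ℕ, ∫ y in ((j : ℝ) / n)..(((j + 1 : ℕ) : ℝ) / n), g ⌊n * y⌋₊ = 1 / n * g j := by
    intro j
    rw [intervalIntegral.integral_of_le (hle j), integral_Ioc_eq_integral_Ioo,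
      ← setIntegral_congr_fun measurableSet_Ioo (hfl j), setIntegral_const]
    simp only [measureReal_def, Real.volume_Ioo, smul_eq_mul]
    rw [ENNReal.toReal_ofReal (sub_nonneg.2 (hle j))]
    congr 1
    push_cast
    field_simp
    ring
  have key := intervalIntegral.sum_integral_adjacent_intervals
    (f := fun y : ℝ => g ⌊n * y⌋₊) (μ := volume) (a := fun j : ℕ => (j : ℝ) / n) (n := m)
    fun j _ => hint j
  simp only [hval, Nat.cast_zero, zero_div] at key
  rw [← integral_Ioc_eq_integral_Ioo, ← intervalIntegral.integral_of_le (by positivity), ← key,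
    Finset.mul_sum]

/-- The weight of a block of size `s` when blocks larger than `x * n` are counted. -/
noncomputable def blockWeight (θ x : ℝ) (n s : ℕ) : ℝ := if x * n < s then θ * n / s else 0

theorem blockWeight_nonneg {θ : ℝ} (hθ : 0 < θ) (x : ℝ) (n s : ℕ) : 0 ≤ blockWeight θ x n s := by
  unfold blockWeight
  split_ifs <;> positivity

theorem blockWeight_le {θ x : ℝ} (hθ : 0 < θ) (hx : 0 < x) (n s : ℕ) :
    blockWeight θ x n s ≤ θ / x := by
  unfold blockWeight
  split_ifs with h
  · have hs : (0 : ℝ) < s := lt_of_le_of_lt (by positivity) h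
    rw [div_le_div_iff₀ hs hx]
    nlinarith
  · positivity

/-- The factorial moments of the number of blocks larger than `x * n`, rescaled. -/
noncomputable def scaledMoment (θ x : ℝ) (k n m : ℕ) : ℝ :=
  (n : ℝ) ^ (1 - θ) * blockMoment θ (x * n) k m

theorem scaledMoment_nonneg {θ : ℝ} (hθ : 0 < θ) (x : ℝ) (k n m : ℕ) :
    0 ≤ scaledMoment θ x k n m :=
  mul_nonneg (Real.rpow_nonneg n.cast_nonneg _) (blockMoment_nonneg hθ _ _ _)

/-- The integrand in the recursion for `scaledMoment`. -/
noncomputable def momentStep (θ x : ℝ) (k n m : ℕ) (y : ℝ) : ℝ :=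
  if n * y < m + 1 then blockWeight θ x n (m - ⌊n * y⌋₊) * scaledMoment θ x k n ⌊n * y⌋₊ else 0

theorem measurable_momentStep (θ x : ℝ) (k n m : ℕ) : Measurable (momentStep θ x k n m) := by
  refine Measurable.ite (measurableSet_lt (by fun_prop) (by fun_prop)) ?_ measurable_const
  exact (measurable_from_nat (f := fun j => blockWeight θ x n (m - j) * scaledMoment θ x k n j)).comp
    (Nat.measurable_floor.comp (measurable_const.mul measurable_id))

/-- The convolution read as the integral of a step function. Since `(m + 1) / n ≤ 2`, the domain
`(0, 2)` serves all `n`. -/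
theorem scaledMoment_succ (θ x : ℝ) (k : ℕ) {n m : ℕ} (hn : 0 < n) (hm : m ≤ n) :
    scaledMoment θ x (k + 1) n m = ∫ y in Set.Ioo (0 : ℝ) 2, momentStep θ x k n m y := by
  have hn' : (0 : ℝ) < n := by exact_mod_cast hn
  have h1 : momentStep θ x k n m = Set.indicator (Set.Iio (((m + 1 : ℕ) : ℝ) / n)) fun y =>
      (fun j => blockWeight θ x n (m - j) * scaledMoment θ x k n j) ⌊n * y⌋₊ := by
    funext y
    unfold momentStep
    rw [Set.indicator_apply]
    simp only [Set.mem_Iio, lt_div_iff₀ hn']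
    push_cast
    simp only [mul_comm]
  have h2 : Set.Ioo (0 : ℝ) 2 ∩ Set.Iio (((m + 1 : ℕ) : ℝ) / n) =
      Set.Ioo 0 (((m + 1 : ℕ) : ℝ) / n) := by
    have : ((m + 1 : ℕ) : ℝ) / n ≤ 2 := by
      rw [div_le_iff₀ hn']
      have h3 : (m : ℝ) ≤ n := by exact_mod_cast hm
      have h4 : (1 : ℝ) ≤ n := by exact_mod_cast hn
      push_cast
      linarith
    ext y
    simp only [Set.mem_inter_iff, Set.mem_Ioo, Set.mem_Iio]
    constructor
    · rintro ⟨⟨a, b⟩, c⟩; exact ⟨a, c⟩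
    · rintro ⟨a, c⟩; exact ⟨⟨a, c.trans_le this⟩, c⟩
  rw [h1, setIntegral_indicator measurableSet_Iio, h2, integral_comp_floor (fun j => blockWeight θ x n (m - j) * scaledMoment θ x k n j) hn]
  unfold scaledMoment
  rw [blockMoment, ← Finset.Nat.sum_antidiagonal_swap,
    Finset.Nat.sum_antidiagonal_eq_sum_range_succ_mk, Finset.mul_sum, Finset.mul_sum]
  refine Finset.sum_congr rfl fun j _ => ?_
  simp only [Prod.swap, blockWeight]
  split_ifs
  · field_simp
  · simp

theorem integrableOn_one_add_rpow {θ : ℝ} (hθ : 0 < θ) (b : ℝ) :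
    IntegrableOn (fun y : ℝ => 1 + y ^ (θ - 1)) (Set.Ioo 0 b) := by
  rcases le_or_gt b 0 with hb | hb
  · rw [Set.Ioo_eq_empty (not_lt.2 hb)]; exact integrableOn_empty
  refine Integrable.add (integrableOn_const (by simp) (by simp)) ?_
  rw [← IntegrableOn, ← intervalIntegrable_iff_integrableOn_Ioo_of_le hb.le]
  exact intervalIntegral.intervalIntegrable_rpow' (by linarith)

theorem momentStep_le {θ x C : ℝ} {k : ℕ} (hθ : 0 < θ) (hx : 0 < x)
    (hC : ∀ n : ℕ, 0 < n → ∀ y : ℝ, 0 < y → ⌊n * y⌋₊ ≤ n →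
      scaledMoment θ x k n ⌊n * y⌋₊ ≤ C * (1 + y ^ (θ - 1)))
    {n m : ℕ} (hn : 0 < n) (hm : m ≤ n) {y : ℝ} (hy : 0 < y) :
    ‖momentStep θ x k n m y‖ ≤ θ / x * (C * (1 + y ^ (θ - 1))) := by
  have hp := Real.rpow_nonneg hy.le (θ - 1)
  have hn' : (0 : ℝ) < n := by exact_mod_cast hn
  unfold momentStep
  split_ifs with h
  · have hfl : ⌊n * y⌋₊ ≤ m := by
      rw [← Nat.lt_succ_iff, Nat.floor_lt (by positivity)]
      push_cast
      exact h
    rw [Real.norm_of_nonneg (mul_nonneg (blockWeight_nonneg hθ _ _ _)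
      (scaledMoment_nonneg hθ _ _ _ _))]
    exact mul_le_mul (blockWeight_le hθ hx _ _) (hC n hn y hy (hfl.trans hm))
      (scaledMoment_nonneg hθ _ _ _ _) (by positivity)
  -- Here the integrand is `0`, so the bound needs `0 ≤ C`; this follows from `hC` with `n = 1` at
  -- the point `min y 1`.
  · have h0 := hC 1 one_pos (min y 1) (by positivity) (by
      simp only [Nat.cast_one, one_mul]
      exact Nat.floor_le_of_le (by simp))
    have : 0 ≤ C := by
      have h1 := (scaledMoment_nonneg hθ _ _ _ _).trans h0
      have h2 := Real.rpow_nonneg (le_min hy.le zero_le_one) (θ - 1)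
      exact nonneg_of_mul_nonneg_left h1 (by linarith)
    rw [norm_zero]
    positivity

/-- The integrable majorant, uniform in `n`. For `k = 0` the moment is at most a constant times `v ^
(θ - 1)` with `v = (j + 1) / n` and `y ≤ v ≤ 2`: the power `y ^ (θ - 1)` handles `θ ≤ 1`, the
summand `1` handles `θ ≥ 1`. Later moments are bounded by constants, namely the integral of the
previous majorant. -/
theorem exists_scaledMoment_le {θ x : ℝ} (hθ : 0 < θ) (hx : 0 < x) (k : ℕ) :
    ∃ C : ℝ, ∀ n : ℕ, 0 < n → ∀ y : ℝ, 0 < y → ⌊n * y⌋₊ ≤ n →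
      scaledMoment θ x k n ⌊n * y⌋₊ ≤ C * (1 + y ^ (θ - 1)) := by
  induction k with
  | zero =>
    obtain ⟨C, hC0, hC⟩ := exists_crpMass_le hθ
    refine ⟨C * 2 ^ θ, fun n hn y hy hfl => ?_⟩
    have hn' : (0 : ℝ) < n := by exact_mod_cast hn
    set j := ⌊n * y⌋₊ with hj
    have hyp := Real.rpow_nonneg hy.le (θ - 1)
    have h2 : (1 : ℝ) ≤ 2 ^ θ := Real.one_le_rpow (by norm_num) hθ.le
    have h1 : scaledMoment θ x 0 n j ≤ C * (((j : ℝ) + 1) / n) ^ (θ - 1) := by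
      unfold scaledMoment
      rw [blockMoment, Real.div_rpow (by positivity) hn'.le, show (1 - θ) = -(θ - 1) by ring,
        Real.rpow_neg hn'.le]
      calc _ ≤ ((n : ℝ) ^ (θ - 1))⁻¹ * (C * ((j : ℝ) + 1) ^ (θ - 1)) := by gcongr; exact hC j
        _ = _ := by ring
    refine h1.trans ?_
    rw [mul_assoc]
    refine mul_le_mul_of_nonneg_left ?_ hC0.le
    have hyv : y ≤ ((j : ℝ) + 1) / n := by
      rw [le_div_iff₀ hn', mul_comm]
      exact (Nat.lt_floor_add_one _).le
    rcases le_total θ 1 with h | h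
    · calc _ ≤ y ^ (θ - 1) := Real.rpow_le_rpow_of_nonpos hy hyv (by linarith)
        _ ≤ _ := by nlinarith
    · have hv2 : ((j : ℝ) + 1) / n ≤ 2 := by
        rw [div_le_iff₀ hn']
        have h3 : (j : ℝ) ≤ n := by exact_mod_cast hfl
        have h4 : (1 : ℝ) ≤ n := by exact_mod_cast hn
        linarith
      calc _ ≤ (2 : ℝ) ^ (θ - 1) := Real.rpow_le_rpow (by positivity) hv2 (by linarith)
        _ ≤ 2 ^ θ := Real.rpow_le_rpow_of_exponent_le (by norm_num) (by linarith)
        _ ≤ _ := by nlinarith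
  | succ k ih =>
    obtain ⟨C, hC⟩ := ih
    set I := ∫ y in Set.Ioo (0 : ℝ) 2, θ / x * (C * (1 + y ^ (θ - 1))) with hI
    refine ⟨|I|, fun n hn y hy hfl => ?_⟩
    have hyp := Real.rpow_nonneg hy.le (θ - 1)
    have h1 : scaledMoment θ x (k + 1) n ⌊n * y⌋₊ ≤ I := by
      rw [scaledMoment_succ θ x k hn hfl]
      refine (le_abs_self _).trans ?_
      rw [← Real.norm_eq_abs]
      refine norm_integral_le_of_norm_le
        (((integrableOn_one_add_rpow hθ 2).const_mul C).const_mul _) ?_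
      filter_upwards [ae_restrict_mem measurableSet_Ioo] with z hz
      exact momentStep_le hθ hx hC hn hfl hz.1
    nlinarith [le_abs_self I, abs_nonneg I]

/-- The limits of the rescaled factorial moments. -/
noncomputable def limitMoment (θ x : ℝ) : ℕ → ℝ → ℝ
  | 0, u => u ^ (θ - 1) / Real.Gamma θ
  | k + 1, u => ∫ y in Set.Ioo 0 (u - x), θ / (u - y) * limitMoment θ x k y

theorem tendsto_floor_mul_div (y : ℝ) (hy : 0 ≤ y) :
    Tendsto (fun n : ℕ => (⌊n * y⌋₊ : ℝ) / n) atTop (𝓝 y) := by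
  have := (tendsto_nat_floor_mul_div_atTop hy).comp tendsto_natCast_atTop_atTop
  refine this.congr fun n => ?_
  simp [mul_comm]

/-- General sequences `m n` with `m n / n → u` simplify the induction, whose inner argument is `⌊n *
y⌋₊`. The integrand converges for `y < u - x`; for `y > u - x` the marked block eventually has size
below `x * n` and weight zero; the point `y = u - x` is null. -/
theorem tendsto_scaledMoment {θ x : ℝ} (hθ : 0 < θ) (hx : 0 < x) (k : ℕ) {m : ℕ → ℕ} {u : ℝ}
    (hu : 0 < u) (hm : ∀ᶠ n in atTop, m n ≤ n)
    (hmu : Tendsto (fun n : ℕ => (m n : ℝ) / n) atTop (𝓝 u)) :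
    Tendsto (fun n => scaledMoment θ x k n (m n)) atTop (𝓝 (limitMoment θ x k u)) := by
  induction k generalizing m u with
  | zero =>
    have hm1 : Tendsto (fun n : ℕ => ((m n : ℝ) + 1) / n) atTop (𝓝 u) := by
      have := hmu.add (tendsto_one_div_atTop_nhds_zero_nat (𝕜 := ℝ))
      rw [add_zero] at this
      exact this.congr fun n => by rw [add_div]
    have hmtop : Tendsto m atTop atTop := by
      rw [← tendsto_natCast_atTop_iff (R := ℝ)]
      have := hmu.pos_mul_atTop hu (tendsto_natCast_atTop_atTop (R := ℝ))
      refine this.congr' ?_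
      filter_upwards [eventually_gt_atTop 0] with n hn
      have : (n : ℝ) ≠ 0 := by positivity
      field_simp
    have := (hm1.rpow_const (p := θ - 1) (Or.inl hu.ne')).mul ((tendsto_crpMass hθ).comp hmtop)
    rw [limitMoment, div_eq_mul_inv]
    refine this.congr' ?_
    filter_upwards [eventually_gt_atTop 0] with n hn
    have hn' : (0 : ℝ) < n := by exact_mod_cast hn
    have h1 : ((m n : ℝ) + 1) ^ (θ - 1) ≠ 0 := (Real.rpow_pos_of_pos (by positivity) _).ne'
    have h2 : (n : ℝ) ^ (θ - 1) ≠ 0 := (Real.rpow_pos_of_pos (by positivity) _).ne'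
    simp only [Function.comp, scaledMoment, blockMoment]
    rw [Real.div_rpow (by positivity) hn'.le, show (1 - θ) = -(θ - 1) by ring,
      Real.rpow_neg hn'.le, Real.rpow_neg (by positivity)]
    field_simp
  | succ k ih =>
    obtain ⟨C, hC⟩ := exists_scaledMoment_le hθ hx k
    have hu1 : u ≤ 1 := by
      refine le_of_tendsto hmu ?_
      filter_upwards [hm] with n hn
      exact div_le_one_of_le₀ (by exact_mod_cast hn) n.cast_nonneg
    have hlim : limitMoment θ x (k + 1) u = ∫ y in Set.Ioo (0 : ℝ) 2,
        Set.indicator (Set.Iio (u - x)) (fun y => θ / (u - y) * limitMoment θ x k y) y := by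
      rw [setIntegral_indicator measurableSet_Iio, limitMoment]
      congr 2
      ext y
      simp only [Set.mem_inter_iff, Set.mem_Ioo, Set.mem_Iio]
      constructor
      · rintro ⟨a, c⟩; exact ⟨⟨a, by linarith⟩, c⟩
      · rintro ⟨⟨a, b⟩, c⟩; exact ⟨a, c⟩
    rw [hlim]
    have hev : (fun n => scaledMoment θ x (k + 1) n (m n)) =ᶠ[atTop] fun n =>
        ∫ y in Set.Ioo (0 : ℝ) 2, momentStep θ x k n (m n) y := by
      filter_upwards [hm, eventually_gt_atTop 0] with n hn hn0
      exact scaledMoment_succ θ x k hn0 hn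
    rw [tendsto_congr' hev]
    refine tendsto_integral_filter_of_dominated_convergence
      (fun y => θ / x * (C * (1 + y ^ (θ - 1)))) ?_ ?_ ?_ ?_
    · exact Eventually.of_forall fun n => (measurable_momentStep θ x k n _).aestronglyMeasurable
    · filter_upwards [hm, eventually_gt_atTop 0] with n hn hn0
      filter_upwards [ae_restrict_mem measurableSet_Ioo] with z hz
      exact momentStep_le hθ hx hC hn0 hn hz.1
    · exact ((integrableOn_one_add_rpow hθ 2).const_mul C).const_mul _
    · have hne : ∀ᵐ y : ℝ ∂(volume.restrict (Set.Ioo 0 2)), y ≠ u - x :=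
        ae_restrict_of_ae (Measure.ae_ne volume _)
      filter_upwards [ae_restrict_mem measurableSet_Ioo, hne] with y hy hyne
      have hfl := tendsto_floor_mul_div y hy.1.le
      have hdiff := hmu.sub hfl
      rcases lt_or_gt_of_ne hyne with hlt | hgt
      · rw [Set.indicator_of_mem (Set.mem_Iio.2 hlt)]
        have huy : x < u - y := by linarith
        have hbeta : Tendsto (fun n => scaledMoment θ x k n ⌊n * y⌋₊) atTop
            (𝓝 (limitMoment θ x k y)) := by
          refine ih hy.1 ?_ hfl
          filter_upwards with n
          refine Nat.floor_le_of_le ?_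
          have : (0 : ℝ) ≤ n := n.cast_nonneg
          nlinarith
        have hw := (tendsto_const_nhds (x := θ)).div hdiff (by linarith)
        refine (hw.mul hbeta).congr' ?_
        filter_upwards [hdiff.eventually_const_lt huy, eventually_gt_atTop 0] with n hn hn0
        have hn' : (0 : ℝ) < n := by exact_mod_cast hn0
        rw [← sub_div, lt_div_iff₀ hn'] at hn
        have hle : ⌊n * y⌋₊ ≤ m n := by
          have : (⌊n * y⌋₊ : ℝ) ≤ m n := by nlinarith
          exact_mod_cast this
        have hlt2 : (n : ℝ) * y < m n + 1 := by
          have h3 := Nat.lt_floor_add_one ((n : ℝ) * y)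
          have h4 : (⌊n * y⌋₊ : ℝ) ≤ m n := by exact_mod_cast hle
          linarith
        unfold momentStep blockWeight
        rw [if_pos hlt2, Nat.cast_sub hle, if_pos hn, Pi.div_apply, ← sub_div]
        have : (m n : ℝ) - ⌊n * y⌋₊ ≠ 0 := by nlinarith
        field_simp
      · rw [Set.indicator_of_notMem (by simp; linarith)]
        have huy : u - y < x := by linarith
        refine (tendsto_const_nhds (x := (0 : ℝ))).congr' ?_
        filter_upwards [hdiff.eventually_lt_const huy, eventually_gt_atTop 0] with n hn hn0
        have hn' : (0 : ℝ) < n := by exact_mod_cast hn0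
        rw [← sub_div, div_lt_iff₀ hn'] at hn
        have hns : ¬ x * n < ((m n - ⌊n * y⌋₊ : ℕ) : ℝ) := by
          rw [not_lt]
          rcases le_total ⌊n * y⌋₊ (m n) with h | h
          · rw [Nat.cast_sub h]; exact hn.le
          · rw [Nat.sub_eq_zero_of_le h]; simp; positivity
        unfold momentStep blockWeight
        rw [if_neg hns, zero_mul, ite_self]

theorem limitMoment_nonneg {θ x : ℝ} (hθ : 0 < θ) (hx : 0 < x) (k : ℕ) {u : ℝ} (hu : 0 < u) :
    0 ≤ limitMoment θ x k u := by
  induction k generalizing u with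
  | zero => exact div_nonneg (Real.rpow_nonneg hu.le _) (Real.Gamma_pos_of_pos hθ).le
  | succ k ih =>
    refine setIntegral_nonneg measurableSet_Ioo fun y hy => mul_nonneg ?_ (ih hy.1)
    have : 0 < u - y := by linarith [hy.2]
    positivity

theorem tendsto_scaledMoment_floor {θ x : ℝ} (hθ : 0 < θ) (hx : 0 < x) (k : ℕ) {u : ℝ}
    (hu : 0 < u) (hu1 : u ≤ 1) :
    Tendsto (fun n : ℕ => scaledMoment θ x k n ⌊n * u⌋₊) atTop (𝓝 (limitMoment θ x k u)) := by
  refine tendsto_scaledMoment hθ hx k hu (Eventually.of_forall fun n => ?_)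
    (tendsto_floor_mul_div u hu.le)
  refine Nat.floor_le_of_le ?_
  have : (0 : ℝ) ≤ n := n.cast_nonneg
  nlinarith

theorem exists_limitMoment_le {θ x : ℝ} (hθ : 0 < θ) (hx : 0 < x) (k : ℕ) :
    ∃ C : ℝ, ∀ u : ℝ, 0 < u → u ≤ 1 → limitMoment θ x k u ≤ C * (1 + u ^ (θ - 1)) := by
  obtain ⟨C, hC⟩ := exists_scaledMoment_le hθ hx k
  refine ⟨C, fun u hu hu1 => le_of_tendsto (tendsto_scaledMoment_floor hθ hx k hu hu1) ?_⟩
  filter_upwards [eventually_gt_atTop 0] with n hn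
  refine hC n hn u hu (Nat.floor_le_of_le ?_)
  have : (0 : ℝ) ≤ n := n.cast_nonneg
  nlinarith

/-- Measurability and the majorant are both inherited from the step functions converging to
`limitMoment`. -/
theorem integrableOn_limitMoment {θ x : ℝ} (hθ : 0 < θ) (hx : 0 < x) (k : ℕ) :
    IntegrableOn (limitMoment θ x k) (Set.Ioo 0 1) := by
  obtain ⟨C, hC⟩ := exists_limitMoment_le hθ hx k
  refine Integrable.mono' ((integrableOn_one_add_rpow hθ 1).const_mul C) ?_ ?_
  · refine aestronglyMeasurable_of_tendsto_ae atTop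
      (f := fun (n : ℕ) (y : ℝ) => scaledMoment θ x k n ⌊n * y⌋₊) (fun n => ?_) ?_
    · exact ((measurable_from_nat (f := scaledMoment θ x k n)).comp
        (Nat.measurable_floor.comp (measurable_const.mul measurable_id))).aestronglyMeasurable
    · filter_upwards [ae_restrict_mem measurableSet_Ioo] with y hy
      exact tendsto_scaledMoment_floor hθ hx k hy.1 hy.2.le
  · filter_upwards [ae_restrict_mem measurableSet_Ioo] with y hy
    rw [Real.norm_of_nonneg (limitMoment_nonneg hθ hx k hy.1)]
    exact hC y hy.1 hy.2.le

theorem integrableOn_div_mul_limitMoment {θ x : ℝ} (hθ : 0 < θ) (hx : 0 < x) (k : ℕ) {u : ℝ}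
    (hu : u ≤ 1) :
    IntegrableOn (fun y => θ / (u - y) * limitMoment θ x k y) (Set.Ioo 0 (u - x)) := by
  have h1 : IntegrableOn (limitMoment θ x k) (Set.Ioo 0 (u - x)) :=
    (integrableOn_limitMoment hθ hx k).mono_set (Set.Ioo_subset_Ioo_right (by linarith))
  refine Integrable.bdd_mul (c := θ / x) h1 (Measurable.aestronglyMeasurable (by fun_prop)) ?_
  filter_upwards [ae_restrict_mem measurableSet_Ioo] with y hy
  have h2 : x < u - y := by linarith [hy.2]
  rw [Real.norm_of_nonneg (div_nonneg hθ.le (hx.trans h2).le)]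
  gcongr

/-! ### The limit moments as integrals over simplices -/

/-- The region `{y_1 > x, …, y_k > x, y_1 + ⋯ + y_k < u}`. -/
def truncatedSimplex (k : ℕ) (x u : ℝ) : Set (Fin k → ℝ) :=
  {y | (∀ j, x < y j) ∧ ∑ j, y j < u}

theorem measurableSet_truncatedSimplex (k : ℕ) (x u : ℝ) :
    MeasurableSet (truncatedSimplex k x u) := by
  refine MeasurableSet.inter ?_ (measurableSet_lt (f := fun y : Fin k → ℝ => ∑ j, y j)
    (by fun_prop) measurable_const)
  have : {y : Fin k → ℝ | ∀ j, x < y j} = ⋂ j, {y | x < y j} := by ext; simp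
  change MeasurableSet {y : Fin k → ℝ | ∀ j, x < y j}
  rw [this]
  exact MeasurableSet.iInter fun j => measurableSet_lt measurable_const (measurable_pi_apply j)

theorem truncatedSimplex_eq_empty {k : ℕ} {x u : ℝ} (h : u ≤ k * x) :
    truncatedSimplex k x u = ∅ := by
  refine Set.eq_empty_of_forall_notMem fun y hy => ?_
  have h1 : ∑ _j : Fin k, x ≤ ∑ j, y j := Finset.sum_le_sum fun j _ => (hy.1 j).le
  simp only [Finset.sum_const, Finset.card_univ, Fintype.card_fin, nsmul_eq_mul] at h1
  linarith [hy.2]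

theorem simplexRegion_one_div (k : ℕ) (x : ℝ) :
    simplexRegion k (1 / x) = truncatedSimplex k x 1 := by
  simp [simplexRegion, truncatedSimplex]

/-- The Dirichlet-type density `(u - ∑ y_j) ^ (θ - 1) / (y_1 ⋯ y_k)`. -/
noncomputable def truncatedIntegrand (θ : ℝ) (k : ℕ) (u : ℝ) (y : Fin k → ℝ) : ℝ :=
  (u - ∑ j, y j) ^ (θ - 1) / ∏ j, y j

theorem measurable_truncatedIntegrand (θ : ℝ) (k : ℕ) (u : ℝ) :
    Measurable (truncatedIntegrand θ k u) := by
  unfold truncatedIntegrand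
  fun_prop

theorem truncatedIntegrand_nonneg (θ : ℝ) {k : ℕ} {x u : ℝ} (hx : 0 < x) {y : Fin k → ℝ}
    (hy : y ∈ truncatedSimplex k x u) : 0 ≤ truncatedIntegrand θ k u y :=
  div_nonneg (Real.rpow_nonneg (sub_nonneg.2 hy.2.le) _)
    (Finset.prod_nonneg fun j _ => (hx.trans (hy.1 j)).le)

/-- Tonelli splits off the first coordinate; the reflection `v ↦ u - v` then makes the remaining
budget the variable. Working with `lintegral` requires no prior integrability. -/
theorem lintegral_truncatedIntegrand_succ (θ : ℝ) {x : ℝ} (hx : 0 < x) (k : ℕ) (u : ℝ) :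
    ∫⁻ y in truncatedSimplex (k + 1) x u, ENNReal.ofReal (truncatedIntegrand θ (k + 1) u y) =
      ∫⁻ v in Set.Ioo 0 (u - x), ENNReal.ofReal (1 / (u - v)) *
        ∫⁻ z in truncatedSimplex k x v, ENNReal.ofReal (truncatedIntegrand θ k v z) := by
  set F : (Fin (k + 1) → ℝ) → ENNReal := (truncatedSimplex (k + 1) x u).indicator
    fun y => ENNReal.ofReal (truncatedIntegrand θ (k + 1) u y) with hF
  have hFm : Measurable F := (measurable_truncatedIntegrand θ (k + 1) u).ennreal_ofReal.indicator
    (measurableSet_truncatedSimplex _ _ _)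
  have hcons : ∀ (v : ℝ) (z : Fin k → ℝ), F (Fin.cons v z) = (Set.Ioi x).indicator (fun v =>
      ENNReal.ofReal (1 / v) * (truncatedSimplex k x (u - v)).indicator
        (fun z => ENNReal.ofReal (truncatedIntegrand θ k (u - v) z)) z) v := by
    intro v z
    by_cases hv : x < v
    · rw [Set.indicator_of_mem (Set.mem_Ioi.2 hv)]
      have hiff : (Fin.cons v z : Fin (k + 1) → ℝ) ∈ truncatedSimplex (k + 1) x u ↔
          z ∈ truncatedSimplex k x (u - v) := by
        constructor
        · rintro ⟨h1, h2⟩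
          rw [Fin.sum_cons] at h2
          exact ⟨fun j => by simpa using h1 j.succ, by linarith⟩
        · rintro ⟨h1, h2⟩
          refine ⟨fun j => Fin.cases (by simpa using hv) (fun j => by simpa using h1 j) j, ?_⟩
          rw [Fin.sum_cons]
          linarith
      by_cases hz : z ∈ truncatedSimplex k x (u - v)
      · rw [hF, Set.indicator_of_mem (hiff.2 hz), Set.indicator_of_mem hz,
          ← ENNReal.ofReal_mul (by have := hx.trans hv; positivity)]
        congr 1
        unfold truncatedIntegrand
        rw [Fin.sum_cons, Fin.prod_cons, sub_sub]
        ring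
      · rw [hF, Set.indicator_of_notMem (fun h => hz (hiff.1 h)), Set.indicator_of_notMem hz,
          mul_zero]
    · rw [Set.indicator_of_notMem (by simpa using hv), hF, Set.indicator_of_notMem]
      exact fun h => hv (by simpa using h.1 0)
  have hmp := (volume_preserving_piFinSuccAbove (fun _ : Fin (k + 1) => ℝ) 0).symm
  rw [← lintegral_indicator (measurableSet_truncatedSimplex _ _ _), ← hmp.lintegral_comp hFm,
    Measure.volume_eq_prod, lintegral_prod (fun p => F ((MeasurableEquiv.piFinSuccAbove
      (fun _ : Fin (k + 1) => ℝ) 0).symm p)) (hFm.comp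
      (MeasurableEquiv.measurable _)).aemeasurable]
  have hinner : ∀ v : ℝ, ∫⁻ z : Fin k → ℝ, F ((MeasurableEquiv.piFinSuccAbove
      (fun _ : Fin (k + 1) => ℝ) 0).symm (v, z)) =
      (Set.Ioo 0 (u - x)).indicator (fun w => ENNReal.ofReal (1 / (u - w)) *
        ∫⁻ z in truncatedSimplex k x w, ENNReal.ofReal (truncatedIntegrand θ k w z)) (u - v) := by
    intro v
    have e : ∀ z : Fin k → ℝ, (MeasurableEquiv.piFinSuccAbove
      (fun _ : Fin (k + 1) => ℝ) 0).symm (v, z) = Fin.cons v z := by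
      intro z
      simp [MeasurableEquiv.piFinSuccAbove, Fin.insertNthEquiv]
    simp only [e, hcons]
    by_cases hv : x < v
    · simp only [Set.indicator_of_mem (Set.mem_Ioi.2 hv)]
      rw [lintegral_const_mul _ ((measurable_truncatedIntegrand θ k _).ennreal_ofReal.indicator
        (measurableSet_truncatedSimplex _ _ _)),
        lintegral_indicator (measurableSet_truncatedSimplex _ _ _)]
      by_cases hvu : v < u
      · rw [Set.indicator_of_mem (Set.mem_Ioo.2 ⟨by linarith, by linarith⟩), sub_sub_cancel]
      · rw [truncatedSimplex_eq_empty, Set.indicator_of_notMem fun h => hvu (by linarith [h.1])]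
        · simp
        · have : (0 : ℝ) ≤ k * x := by positivity
          linarith
    · rw [Set.indicator_of_notMem fun h => hv (by linarith [h.2])]
      simp only [Set.indicator_of_notMem (show v ∉ Set.Ioi x from hv), lintegral_zero]
  simp only [hinner]
  rw [lintegral_sub_left_eq_self (μ := volume) (fun w => (Set.Ioo 0 (u - x)).indicator
    (fun w => ENNReal.ofReal (1 / (u - w)) *
      ∫⁻ z in truncatedSimplex k x w, ENNReal.ofReal (truncatedIntegrand θ k w z)) w) u,
    lintegral_indicator measurableSet_Ioo]

/-- Both sides obey the same recursion, apart from a factor `θ` per step and the initial `1 / Γ(θ)`.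
Finiteness of the right side later gives absolute convergence. -/
theorem lintegral_truncatedIntegrand {θ x : ℝ} (hθ : 0 < θ) (hx : 0 < x) (k : ℕ) {u : ℝ}
    (hu : 0 < u) (hu1 : u ≤ 1) :
    ∫⁻ y in truncatedSimplex k x u, ENNReal.ofReal (truncatedIntegrand θ k u y) =
      ENNReal.ofReal (Real.Gamma θ / θ ^ k * limitMoment θ x k u) := by
  have hΓ := Real.Gamma_pos_of_pos hθ
  induction k generalizing u with
  | zero =>
    have h1 : truncatedSimplex 0 x u = Set.univ := by
      ext y; simp [truncatedSimplex, hu]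
    rw [h1, Measure.restrict_univ, lintegral_unique]
    have h2 : (volume : Measure (Fin 0 → ℝ)) Set.univ = 1 := by
      rw [volume_pi, Measure.pi_univ]; simp
    rw [h2, mul_one]
    congr 1
    simp only [truncatedIntegrand, limitMoment, Finset.univ_eq_empty, Finset.sum_empty,
      Finset.prod_empty, sub_zero, div_one, pow_zero]
    field_simp
  | succ k ih =>
    rw [lintegral_truncatedIntegrand_succ θ hx, limitMoment, ← integral_const_mul,
      ofReal_integral_eq_lintegral_ofReal
        ((integrableOn_div_mul_limitMoment hθ hx k hu1).const_mul _)]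
    · refine setLIntegral_congr_fun measurableSet_Ioo fun y hy => ?_
      have hy2 : 0 < u - y := by linarith [hy.2]
      rw [ih hy.1 (by linarith), ← ENNReal.ofReal_mul (by positivity)]
      congr 1
      field_simp
      ring
    · filter_upwards [ae_restrict_mem measurableSet_Ioo] with y hy
      have hy2 : 0 < u - y := by linarith [hy.2]
      have := limitMoment_nonneg hθ hx k hy.1
      simp only [Pi.zero_apply]
      positivity

theorem integrableOn_truncatedIntegrand {θ x : ℝ} (hθ : 0 < θ) (hx : 0 < x) (k : ℕ) :
    IntegrableOn (truncatedIntegrand θ k 1) (truncatedSimplex k x 1) := by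
  refine ⟨(measurable_truncatedIntegrand θ k 1).aestronglyMeasurable, ?_⟩
  rw [hasFiniteIntegral_iff_ofReal, lintegral_truncatedIntegrand hθ hx k one_pos le_rfl]
  · exact ENNReal.ofReal_lt_top
  · filter_upwards [ae_restrict_mem (measurableSet_truncatedSimplex _ _ _)] with y hy
    exact truncatedIntegrand_nonneg θ hx hy

theorem integral_truncatedIntegrand {θ x : ℝ} (hθ : 0 < θ) (hx : 0 < x) (k : ℕ) :
    ∫ y in truncatedSimplex k x 1, truncatedIntegrand θ k 1 y =
      Real.Gamma θ / θ ^ k * limitMoment θ x k 1 := by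
  rw [integral_eq_lintegral_of_nonneg_ae, lintegral_truncatedIntegrand hθ hx k one_pos le_rfl,
    ENNReal.toReal_ofReal]
  · exact mul_nonneg (div_nonneg (Real.Gamma_pos_of_pos hθ).le (by positivity))
      (limitMoment_nonneg hθ hx k one_pos)
  · filter_upwards [ae_restrict_mem (measurableSet_truncatedSimplex _ _ _)] with y hy
    exact truncatedIntegrand_nonneg θ hx hy
  · exact (measurable_truncatedIntegrand θ k 1).aestronglyMeasurable

/-! ### Convergence of the distribution functions -/

/-- The probability that no branch of the Hoppe tree on `n` nodes is larger than `x * n`. -/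
noncomputable def hoppeCdf (θ : ℝ) (n : ℕ) (x : ℝ) : ℝ :=
  crp θ (n - 1) (fun l => if ∀ s ∈ l, (s : ℝ) ≤ x * n then 1 else 0) / crpMass θ (n - 1)

theorem hoppeCdf_nonneg {θ : ℝ} (hθ : 0 < θ) (n : ℕ) (x : ℝ) : 0 ≤ hoppeCdf θ n x := by
  refine div_nonneg ?_ (crpMass_pos hθ _).le
  have h := crp_const_mul θ (n - 1) 0 fun _ => 0
  simp only [mul_zero, zero_mul] at h
  refine h.ge.trans (crp_mono hθ fun l _ => ?_)
  split_ifs <;> norm_num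

theorem hoppeCdf_mono {θ : ℝ} (hθ : 0 < θ) (n : ℕ) : Monotone (hoppeCdf θ n) := by
  intro x y hxy
  refine div_le_div_of_nonneg_right (crp_mono hθ fun l _ => ?_) (crpMass_pos hθ _).le
  have h1 : x * n ≤ y * n := by gcongr
  by_cases h : ∀ s ∈ l, (s : ℝ) ≤ x * n
  · rw [if_pos h, if_pos fun s hs => (h s hs).trans h1]
  · rw [if_neg h]
    split_ifs <;> norm_num

theorem kingmanTerm_one_div {θ x : ℝ} (hθ : 0 < θ) (hx : 0 < x) (k : ℕ) :
    kingmanTerm θ k (1 / x) = (-1) ^ k / k ! * (Real.Gamma θ * limitMoment θ x k 1) := by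
  have h := integral_truncatedIntegrand hθ hx k
  unfold kingmanTerm
  rw [simplexRegion_one_div]
  change _ * ∫ y in truncatedSimplex k x 1, truncatedIntegrand θ k 1 y = _
  rw [h, neg_pow]
  field_simp

theorem kingmanTerm_eq_zero {θ x : ℝ} {k : ℕ} (hk : 1 ≤ k * x) : kingmanTerm θ k (1 / x) = 0 := by
  unfold kingmanTerm
  rw [simplexRegion_one_div, truncatedSimplex_eq_empty hk]
  simp

theorem kingmanTerm_zero {θ x : ℝ} (hθ : 0 < θ) (hx : 0 < x) : kingmanTerm θ 0 (1 / x) = 1 := by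
  rw [kingmanTerm_one_div hθ hx, limitMoment]
  have := (Real.Gamma_pos_of_pos hθ).ne'
  simp
  field_simp

/-- The regions are empty once `(k + 1) * x ≥ 1`, so the series is a finite sum. -/
theorem summable_kingmanTerm {θ x : ℝ} (hx : 0 < x) :
    Summable (fun k : ℕ => kingmanTerm θ (k + 1) (1 / x)) := by
  obtain ⟨K, hK⟩ := exists_nat_ge (1 / x)
  rw [div_le_iff₀ hx] at hK
  refine summable_of_ne_finset_zero (s := Finset.range K) fun k hk => kingmanTerm_eq_zero ?_
  have : (K : ℝ) ≤ k := by exact_mod_cast not_lt.1 fun h => hk (Finset.mem_range.2 h)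
  push_cast
  nlinarith

theorem kingmanF_eq_tsum {θ x : ℝ} (hθ : 0 < θ) (hx : 0 < x) :
    kingmanF θ x = 1 + ∑' k : ℕ, kingmanTerm θ (k + 1) (1 / x) := by
  unfold kingmanF kingmanP
  have h1 := (Real.Gamma_pos_of_pos hθ).ne'
  have h2 : x ^ (θ - 1) ≠ 0 := (Real.rpow_pos_of_pos hx _).ne'
  rw [Real.exp_neg, one_div, Real.inv_rpow hx.le]
  have h3 := (Real.exp_pos (Real.eulerMascheroniConstant * θ)).ne'
  field_simp

theorem kingmanF_eq_sum {θ x : ℝ} (hθ : 0 < θ) (hx : 0 < x) {K : ℕ} (hK : 1 ≤ K * x) :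
    kingmanF θ x = ∑ k ∈ Finset.range (K + 1), kingmanTerm θ k (1 / x) := by
  rw [kingmanF_eq_tsum hθ hx, Finset.sum_range_succ', kingmanTerm_zero hθ hx, add_comm,
    tsum_eq_sum (s := Finset.range K)]
  intro k hk
  have : (K : ℝ) ≤ k := by exact_mod_cast not_lt.1 fun h => hk (Finset.mem_range.2 h)
  refine kingmanTerm_eq_zero ?_
  push_cast
  nlinarith

theorem kingmanF_eq_one {θ x : ℝ} (hθ : 0 < θ) (hx : 1 ≤ x) : kingmanF θ x = 1 := by
  have hx0 : 0 < x := by linarith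
  rw [kingmanF_eq_sum hθ hx0 (K := 1) (by simpa using hx), Finset.sum_range_succ,
    Finset.sum_range_one, kingmanTerm_zero hθ hx0, kingmanTerm_eq_zero (by simpa using hx), add_zero]

/-- Dividing by the total weight is dividing by the zeroth moment, so the powers of `n` cancel and
the limit `1 / Γ(θ)` of the denominator supplies the factor `Γ(θ)`. -/
theorem tendsto_hoppeCdf {θ x : ℝ} (hθ : 0 < θ) (hx : 0 < x) :
    Tendsto (fun n => hoppeCdf θ n x) atTop (𝓝 (kingmanF θ x)) := by
  obtain ⟨K, hK⟩ := exists_nat_ge (1 / x)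
  rw [div_le_iff₀ hx] at hK
  have hΓ := Real.Gamma_pos_of_pos hθ
  have hm : Tendsto (fun n : ℕ => ((n - 1 : ℕ) : ℝ) / n) atTop (𝓝 1) := by
    have := (tendsto_const_nhds (x := (1 : ℝ))).sub (tendsto_one_div_atTop_nhds_zero_nat (𝕜 := ℝ))
    rw [sub_zero] at this
    refine this.congr' ?_
    filter_upwards [eventually_gt_atTop 0] with n hn
    have hn' : (n : ℝ) ≠ 0 := by positivity
    rw [Nat.cast_sub hn]
    field_simp
    simp
  have hs := fun k => tendsto_scaledMoment hθ hx k one_pos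
    (Eventually.of_forall fun n => Nat.sub_le n 1) hm
  have h0 : limitMoment θ x 0 1 = (Real.Gamma θ)⁻¹ := by simp [limitMoment]
  have h1 : Tendsto (fun n => ∑ k ∈ Finset.range (K + 1), (-1 : ℝ) ^ k / k ! *
      (scaledMoment θ x k n (n - 1) / scaledMoment θ x 0 n (n - 1))) atTop
      (𝓝 (kingmanF θ x)) := by
    rw [kingmanF_eq_sum hθ hx hK]
    refine tendsto_finsetSum _ fun k _ => ?_
    rw [kingmanTerm_one_div hθ hx]
    refine Tendsto.const_mul _ ?_
    have := (hs k).div (hs 0) (by rw [h0]; exact inv_ne_zero hΓ.ne')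
    rwa [h0, div_inv_eq_mul, mul_comm] at this
  refine h1.congr' ?_
  filter_upwards [eventually_gt_atTop 0] with n hn
  have hn' : (0 : ℝ) < n := by exact_mod_cast hn
  unfold hoppeCdf
  rw [crp_forall_le (K := K + 1) (by positivity), Finset.sum_div]
  · refine Finset.sum_congr rfl fun k _ => ?_
    have h2 := (crpMass_pos hθ (n - 1)).ne'
    have h3 : (n : ℝ) ^ (1 - θ) ≠ 0 := (Real.rpow_pos_of_pos hn' _).ne'
    unfold scaledMoment
    rw [mul_div_mul_left _ _ h3, blockMoment.eq_1 θ, mul_div_assoc]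
  · rw [Nat.cast_sub hn]
    push_cast
    nlinarith

/-! ### No mass at zero, and right continuity of the limit -/

theorem exists_le_crpMass {θ : ℝ} (hθ : 0 < θ) :
    ∃ C : ℝ, 0 < C ∧ ∀ m : ℕ, ((m : ℝ) + 1) ^ (θ - 1) ≤ C * crpMass θ m := by
  obtain ⟨C, hC⟩ := ((tendsto_crpMass hθ).inv₀
    (inv_ne_zero (Real.Gamma_pos_of_pos hθ).ne')).bddAbove_range
  refine ⟨max C 1, by positivity, fun m => ?_⟩
  have h := hC (Set.mem_range_self m)
  have hp : 0 < ((m : ℝ) + 1) ^ (θ - 1) := Real.rpow_pos_of_pos (by positivity) _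
  have hq := crpMass_pos hθ m
  rw [show (1 - θ) = -(θ - 1) by ring, Real.rpow_neg (by positivity)] at h
  calc ((m : ℝ) + 1) ^ (θ - 1) =
      ((((m : ℝ) + 1) ^ (θ - 1))⁻¹ * crpMass θ m)⁻¹ * crpMass θ m := by field_simp
    _ ≤ C * crpMass θ m := by gcongr
    _ ≤ _ := by gcongr; exact le_max_left _ _

theorem rpow_le_two_mul_rpow {a b θ : ℝ} (hθ : 0 < θ) (hb : 0 < b) (hab : b / 2 ≤ a)
    (ha : a ≤ b) : a ^ (θ - 1) ≤ 2 * b ^ (θ - 1) := by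
  have hbp := Real.rpow_pos_of_pos hb (θ - 1)
  rcases le_total θ 1 with h | h
  · calc a ^ (θ - 1) ≤ (b / 2) ^ (θ - 1) :=
        Real.rpow_le_rpow_of_nonpos (by positivity) hab (by linarith)
      _ = 2 ^ (1 - θ) * b ^ (θ - 1) := by
        rw [Real.div_rpow hb.le zero_le_two, show (1 - θ) = -(θ - 1) by ring,
          Real.rpow_neg zero_le_two]
        ring
      _ ≤ 2 ^ (1 : ℝ) * b ^ (θ - 1) := by
        gcongr
        · norm_num
        · linarith
      _ = _ := by rw [Real.rpow_one]
  · have : a ^ (θ - 1) ≤ b ^ (θ - 1) := Real.rpow_le_rpow (by linarith) ha (by linarith)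
    linarith

/-- In `mul_crp_forall_le_le` at most `t = x * n` sizes contribute. As `x ≤ 1/2`, each leaves at
least half of `m + 1` in `p.2 + 1`, so its weight is comparable to the total weight. -/
theorem exists_hoppeCdf_le {θ : ℝ} (hθ : 0 < θ) :
    ∃ C : ℝ, ∀ n : ℕ, 2 ≤ n → ∀ x : ℝ, 0 ≤ x → x ≤ 1 / 2 → hoppeCdf θ n x ≤ C * x := by
  obtain ⟨C, hC0, hC⟩ := exists_crpMass_le hθ
  obtain ⟨D, hD0, hD⟩ := exists_le_crpMass hθ
  -- One factor `2` comes from `rpow_le_two_mul_rpow`, the other from `m + 1 ≤ 2 * m`.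
  refine ⟨4 * θ * C * D, fun n hn x hx hx2 => ?_⟩
  obtain ⟨m, rfl⟩ : ∃ m, n = m + 1 := ⟨n - 1, by omega⟩
  have hm : (1 : ℝ) ≤ m := by exact_mod_cast (by omega : 1 ≤ m)
  set t : ℝ := x * ((m + 1 : ℕ) : ℝ) with ht
  have ht0 : 0 ≤ t := by positivity
  have hqm := crpMass_pos hθ m
  have hpow : 0 < ((m : ℝ) + 1) ^ (θ - 1) := Real.rpow_pos_of_pos (by positivity) _
  have h1 := mul_crp_forall_le_le (t := t) hθ m
  have h2 : ∑ p ∈ Finset.HasAntidiagonal.antidiagonal m,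
      (if p.1 ≠ 0 ∧ (p.1 : ℝ) ≤ t then θ else 0) * crpMass θ p.2 ≤
      ∑ p ∈ Finset.HasAntidiagonal.antidiagonal m,
        (if p.1 ≠ 0 ∧ (p.1 : ℝ) ≤ t then 1 else 0) *
          (2 * θ * C * ((m : ℝ) + 1) ^ (θ - 1)) := by
    refine Finset.sum_le_sum fun p hp => ?_
    have hp' : (p.1 : ℝ) + p.2 = m := by
      exact_mod_cast Finset.HasAntidiagonal.mem_antidiagonal.1 hp
    split_ifs with h
    · rw [one_mul]
      have hpt := h.2
      rw [ht] at hpt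
      push_cast at hpt
      have h3 : ((p.2 : ℝ) + 1) ^ (θ - 1) ≤ 2 * ((m : ℝ) + 1) ^ (θ - 1) :=
        rpow_le_two_mul_rpow hθ (by positivity) (by nlinarith)
          (by linarith [p.1.cast_nonneg (α := ℝ)])
      calc θ * crpMass θ p.2 ≤ θ * (C * ((p.2 : ℝ) + 1) ^ (θ - 1)) := by gcongr; exact hC _
        _ ≤ θ * (C * (2 * ((m : ℝ) + 1) ^ (θ - 1))) := by gcongr
        _ = _ := by ring
    · simp
  have h4 : ∑ p ∈ Finset.HasAntidiagonal.antidiagonal m,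
      (if p.1 ≠ 0 ∧ (p.1 : ℝ) ≤ t then (1 : ℝ) else 0) ≤ t := by
    rw [Finset.Nat.sum_antidiagonal_eq_sum_range_succ_mk, Finset.sum_boole]
    refine le_trans ?_ (Nat.floor_le ht0)
    have : (Finset.range m.succ).filter (fun k : ℕ => k ≠ 0 ∧ (k : ℝ) ≤ t) ⊆
        Finset.Icc 1 ⌊t⌋₊ := by
      intro k hk
      obtain ⟨-, h5, h6⟩ := Finset.mem_filter.1 hk
      exact Finset.mem_Icc.2 ⟨Nat.one_le_iff_ne_zero.2 h5, Nat.le_floor h6⟩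
    have h5 := Finset.card_le_card this
    rw [Nat.card_Icc, Nat.add_sub_cancel] at h5
    exact_mod_cast h5
  rw [← Finset.sum_mul] at h2
  have h6 : m * crp θ m (fun l => if ∀ s ∈ l, (s : ℝ) ≤ t then 1 else 0) ≤
      t * (2 * θ * C * (D * crpMass θ m)) := by
    refine (h1.trans h2).trans (mul_le_mul h4 ?_ (by positivity) ht0)
    gcongr
    exact hD m
  change crp θ m (fun l => if ∀ s ∈ l, (s : ℝ) ≤ t then 1 else 0) / crpMass θ m ≤ _
  rw [div_le_iff₀ hqm]
  have h7 : t ≤ m * (2 * x) := by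
    rw [ht]; push_cast; nlinarith
  refine le_of_mul_le_mul_left (h6.trans ?_) (by linarith : (0 : ℝ) < m)
  calc t * (2 * θ * C * (D * crpMass θ m)) ≤ m * (2 * x) * (2 * θ * C * (D * crpMass θ m)) := by
        gcongr
    _ = _ := by ring

/-- The limiting distribution function. -/
noncomputable def limitCdf (θ x : ℝ) : ℝ := if 0 < x then kingmanF θ x else 0

theorem tendsto_hoppeCdf_of_nonneg {θ x : ℝ} (hθ : 0 < θ) (hx : 0 ≤ x) :
    Tendsto (fun n => hoppeCdf θ n x) atTop (𝓝 (limitCdf θ x)) := by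
  rcases hx.eq_or_lt with rfl | hx
  · rw [limitCdf, if_neg (lt_irrefl _)]
    obtain ⟨C, hC⟩ := exists_hoppeCdf_le hθ
    refine tendsto_const_nhds.congr' ?_
    filter_upwards [eventually_ge_atTop 2] with n hn
    refine le_antisymm (hoppeCdf_nonneg hθ n 0) ?_
    simpa using hC n hn 0 le_rfl (by norm_num)
  · rw [limitCdf, if_pos hx]
    exact tendsto_hoppeCdf hθ hx

theorem limitCdf_mono {θ : ℝ} (hθ : 0 < θ) : Monotone (limitCdf θ) := by
  intro x y hxy
  by_cases hy : 0 ≤ y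
  · have hy' := tendsto_hoppeCdf_of_nonneg hθ hy
    by_cases hx : 0 ≤ x
    · exact le_of_tendsto_of_tendsto' (tendsto_hoppeCdf_of_nonneg hθ hx) hy' fun n =>
        hoppeCdf_mono hθ n hxy
    · rw [limitCdf, if_neg (by linarith)]
      exact ge_of_tendsto' hy' fun n => hoppeCdf_nonneg hθ n y
  · rw [limitCdf, limitCdf, if_neg (by linarith), if_neg (by linarith)]

/-- The constraints `x < y j` are strict, so the regions for `z` increase to the region for `x` as
`z` decreases to `x`; the integrand on the latter dominates. -/
theorem continuousWithinAt_kingmanTerm {θ x : ℝ} (hθ : 0 < θ) (hx : 0 < x) (k : ℕ) :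
    ContinuousWithinAt (fun x => kingmanTerm θ k (1 / x)) (Set.Ici x) x := by
  unfold kingmanTerm
  refine ContinuousWithinAt.mul continuousWithinAt_const ?_
  simp only [simplexRegion_one_div]
  have h : ∀ z, ∫ y in truncatedSimplex k z 1, simplexIntegrand θ k y =
      ∫ y, (truncatedSimplex k z 1).indicator (truncatedIntegrand θ k 1) y := fun z =>
    (integral_indicator (measurableSet_truncatedSimplex k z 1)).symm
  simp only [h]
  refine tendsto_integral_filter_of_dominated_convergence
    (fun y => ‖(truncatedSimplex k x 1).indicator (truncatedIntegrand θ k 1) y‖) ?_ ?_ ?_ ?_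
  · exact Eventually.of_forall fun z => ((measurable_truncatedIntegrand θ k 1).indicator
      (measurableSet_truncatedSimplex k z 1)).aestronglyMeasurable
  · filter_upwards [self_mem_nhdsWithin] with z hz
    refine Eventually.of_forall fun y => ?_
    refine norm_indicator_le_of_subset (s := truncatedSimplex k z 1)
      (t := truncatedSimplex k x 1) (fun y hy => ?_) _ _
    exact ⟨fun j => lt_of_le_of_lt hz (hy.1 j), hy.2⟩
  · exact (((integrable_indicator_iff (measurableSet_truncatedSimplex k x 1)).2
      (integrableOn_truncatedIntegrand hθ hx k))).norm
  · refine Eventually.of_forall fun y => ?_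
    refine tendsto_const_nhds.congr' ?_
    by_cases hy : y ∈ truncatedSimplex k x 1
    · have h1 : ∀ᶠ z in 𝓝[≥] x, ∀ j, z < y j := eventually_all.2 fun j =>
        nhdsWithin_le_nhds (Iio_mem_nhds (hy.1 j))
      filter_upwards [h1] with z hz
      rw [Set.indicator_of_mem hy, Set.indicator_of_mem (show y ∈ truncatedSimplex k z 1 from ⟨hz, hy.2⟩)]
    · filter_upwards [self_mem_nhdsWithin] with z hz
      rw [Set.indicator_of_notMem hy, Set.indicator_of_notMem]
      exact fun h => hy ⟨fun j => lt_of_le_of_lt hz (h.1 j), h.2⟩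

/-- At `0` the linear bound survives the limit. For `x > 0` one truncation `K` serves every `z ≥ x`,
leaving a finite sum of right-continuous terms. -/
theorem limitCdf_rightContinuous {θ : ℝ} (hθ : 0 < θ) (x : ℝ) :
    ContinuousWithinAt (limitCdf θ) (Set.Ici x) x := by
  rcases lt_trichotomy x 0 with hx | rfl | hx
  · refine ContinuousAt.continuousWithinAt ?_
    refine (continuousAt_const (y := (0 : ℝ))).congr ?_
    filter_upwards [Iio_mem_nhds hx] with z hz
    rw [limitCdf, if_neg (not_lt.2 (le_of_lt hz))]
  · obtain ⟨C, hC⟩ := exists_hoppeCdf_le hθ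
    have h0 : limitCdf θ 0 = 0 := by rw [limitCdf, if_neg (lt_irrefl _)]
    rw [ContinuousWithinAt, h0]
    have hlim : Tendsto (fun z : ℝ => C * z) (𝓝[≥] 0) (𝓝 0) := by
      have : Tendsto (fun z : ℝ => C * z) (𝓝 0) (𝓝 (C * 0)) := tendsto_id.const_mul C
      rw [mul_zero] at this
      exact this.mono_left nhdsWithin_le_nhds
    refine tendsto_of_tendsto_of_tendsto_of_le_of_le' tendsto_const_nhds hlim ?_ ?_
    · filter_upwards [self_mem_nhdsWithin] with z hz
      exact h0 ▸ limitCdf_mono hθ hz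
    · filter_upwards [self_mem_nhdsWithin, nhdsWithin_le_nhds (Iio_mem_nhds
        (show (0 : ℝ) < 1 / 2 by norm_num))] with z hz hz2
      refine le_of_tendsto (tendsto_hoppeCdf_of_nonneg hθ hz) ?_
      filter_upwards [eventually_ge_atTop 2] with n hn
      exact hC n hn z hz (le_of_lt hz2)
  · obtain ⟨K, hK⟩ := exists_nat_ge (1 / x)
    rw [div_le_iff₀ hx] at hK
    have heq : ∀ z ∈ Set.Ici x, limitCdf θ z =
        ∑ k ∈ Finset.range (K + 1), kingmanTerm θ k (1 / z) := by
      intro z hz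
      have hz' : x ≤ z := hz
      rw [limitCdf, if_pos (hx.trans_le hz'), kingmanF_eq_sum hθ (hx.trans_le hz')]
      refine hK.trans ?_
      gcongr
    refine ContinuousWithinAt.congr ?_ heq (heq x Set.self_mem_Ici)
    exact tendsto_finsetSum _ fun k _ => continuousWithinAt_kingmanTerm hθ hx k

/-- The limiting distribution function as a Stieltjes function. -/
noncomputable def limitStieltjes {θ : ℝ} (hθ : 0 < θ) : StieltjesFunction ℝ where
  toFun := limitCdf θ
  mono' := limitCdf_mono hθ
  right_continuous' := limitCdf_rightContinuous hθ

theorem exists_limitMeasure {θ : ℝ} (hθ : 0 < θ) :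
    ∃ μ : ProbabilityMeasure ℝ, ∀ x, cdf (μ : Measure ℝ) x = limitCdf θ x := by
  have h0 : Tendsto (limitStieltjes hθ) atBot (𝓝 0) := by
    refine tendsto_const_nhds.congr' ?_
    filter_upwards [eventually_le_atBot 0] with x hx
    exact (if_neg (not_lt.2 hx)).symm
  have h1 : Tendsto (limitStieltjes hθ) atTop (𝓝 1) := by
    refine tendsto_const_nhds.congr' ?_
    filter_upwards [eventually_ge_atTop 1] with x hx
    change 1 = limitCdf θ x
    rw [limitCdf, if_pos (by linarith), kingmanF_eq_one hθ hx]
  refine ⟨⟨(limitStieltjes hθ).measure, StieltjesFunction.isProbabilityMeasure _ h0 h1⟩, fun x => ?_⟩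
  rw [ProbabilityMeasure.coe_mk, cdf_measure_stieltjesFunction _ h0 h1]
  rfl

/-! ### Weak convergence of the largest branch -/

/-- Half-open intervals form a π-system containing small neighbourhoods of every point, and their
masses are differences of distribution functions. -/
theorem tendsto_probabilityMeasure_of_tendsto_cdf {μ : ℕ → ProbabilityMeasure ℝ}
    {ν : ProbabilityMeasure ℝ}
    (h : ∀ x, Tendsto (fun n => cdf (μ n : Measure ℝ) x) atTop (𝓝 (cdf (ν : Measure ℝ) x))) :
    Tendsto μ atTop (𝓝 ν) := by
  have hIoc : ∀ (ρ : ProbabilityMeasure ℝ) (a b : ℝ), a ≤ b → ((ρ (Set.Ioc a b) : NNReal) : ℝ) =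
      cdf (ρ : Measure ℝ) b - cdf (ρ : Measure ℝ) a := by
    intro ρ a b hab
    have h1 : (ρ : Measure ℝ) (Set.Ioc a b) =
        ENNReal.ofReal (cdf (ρ : Measure ℝ) b - cdf (ρ : Measure ℝ) a) := by
      conv_lhs => rw [← measure_cdf (ρ : Measure ℝ)]
      rw [StieltjesFunction.measure_Ioc]
    change ((ρ : Measure ℝ) (Set.Ioc a b)).toReal = _
    rw [h1, ENNReal.toReal_ofReal (sub_nonneg.2 (monotone_cdf _ hab))]
  refine IsPiSystem.tendsto_probabilityMeasure_of_tendsto_of_mem (isPiSystem_Ioc (id : ℝ → ℝ) id)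
    ?_ ?_ ?_
  · rintro s ⟨a, b, -, rfl⟩
    exact measurableSet_Ioc
  · intro u hu x hx
    obtain ⟨ε, hε, hb⟩ := Metric.isOpen_iff.1 hu x hx
    refine ⟨Set.Ioc (x - ε / 2) (x + ε / 2), ⟨x - ε / 2, x + ε / 2, by simp only [id]; linarith, rfl⟩,
      Ioc_mem_nhds (by linarith) (by linarith), fun y hy => hb ?_⟩
    rw [Metric.mem_ball, Real.dist_eq, abs_lt]
    constructor <;> linarith [hy.1, hy.2]
  · rintro s ⟨a, b, hab, rfl⟩
    rw [← NNReal.tendsto_coe]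
    simp only [id] at hab ⊢
    simp only [hIoc _ a b hab.le]
    exact (h b).sub (h a)

theorem integral_hoppeTree {θ : ℝ} (hθ : 0 < θ) {n : ℕ} (g : RecursiveTree n → ℝ) :
    ∫ T, g T ∂(hoppeTree θ hθ n).toMeasure = ∑ T, T.hoppeWeight θ * g T := by
  rw [PMF.integral_eq_sum]
  refine Finset.sum_congr rfl fun T _ => ?_
  rw [hoppeTree, PMF.ofFintype_apply,
    ENNReal.toReal_ofReal (RecursiveTree.hoppeWeight_nonneg hθ T), smul_eq_mul]

theorem measurableSet_recursiveTree {n : ℕ} (s : Set (RecursiveTree n)) : MeasurableSet s :=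
  s.toFinite.measurableSet

theorem measurable_recursiveTree {n : ℕ} {α : Type*} [MeasurableSpace α]
    (g : RecursiveTree n → α) : Measurable g := fun _ _ => measurableSet_recursiveTree _

theorem measureReal_largestBranch_le {θ : ℝ} (hθ : 0 < θ) {n : ℕ} (hn : 0 < n) {x : ℝ}
    (hx : 0 ≤ x) :
    (hoppeTree θ hθ n).toMeasure.real {T | (T.largestBranch : ℝ) ≤ x * n} = hoppeCdf θ n x := by
  obtain ⟨m, rfl⟩ : ∃ m, n = m + 1 := ⟨n - 1, by omega⟩
  rw [← integral_indicator_one (measurableSet_recursiveTree _), integral_hoppeTree hθ]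
  have h : ∀ T : RecursiveTree (m + 1),
      ({T : RecursiveTree (m + 1) | (T.largestBranch : ℝ) ≤ x * ((m + 1 : ℕ) : ℝ)}.indicator 1 T :
        ℝ) = if ∀ s ∈ T.branchSizes, (s : ℝ) ≤ x * ((m + 1 : ℕ) : ℝ) then 1 else 0 := by
    intro T
    rw [Set.indicator_apply]
    simp only [Set.mem_ofPred_eq, T.largestBranch_le_iff (by positivity : 0 ≤ x * ((m + 1 : ℕ) : ℝ)),
      Pi.one_apply]
  simp only [h]
  exact RecursiveTree.sum_hoppeWeight_mul hθ m
    fun l => if ∀ s ∈ l, (s : ℝ) ≤ x * ((m + 1 : ℕ) : ℝ) then 1 else 0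

theorem cdf_map_largestBranch {θ : ℝ} (hθ : 0 < θ) {n : ℕ} (hn : 0 < n) (x : ℝ) :
    cdf ((hoppeTree θ hθ n).toMeasure.map
      fun T : RecursiveTree n => (T.largestBranch : ℝ) / n) x =
      if 0 ≤ x then hoppeCdf θ n x else 0 := by
  have hm := measurable_recursiveTree fun T : RecursiveTree n => (T.largestBranch : ℝ) / n
  have := Measure.isProbabilityMeasure_map (μ := (hoppeTree θ hθ n).toMeasure) hm.aemeasurable
  have hn' : (0 : ℝ) < n := by exact_mod_cast hn
  rw [cdf_eq_real, map_measureReal_apply hm measurableSet_Iic]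
  split_ifs with hx
  · rw [← measureReal_largestBranch_le hθ hn hx]
    congr 1
    ext T
    simp only [Set.mem_preimage, Set.mem_Iic, Set.mem_ofPred_eq, div_le_iff₀ hn']
  · have : (fun T : RecursiveTree n => (T.largestBranch : ℝ) / n) ⁻¹' Set.Iic x = ∅ := by
      refine Set.eq_empty_of_forall_notMem fun T hT => hx (le_trans ?_ (Set.mem_Iic.1 hT))
      positivity
    rw [this, measureReal_empty]

theorem tendstoInDistribution_largestBranch {θ : ℝ} (hθ : 0 < θ) {μ : ProbabilityMeasure ℝ}
    (hμ : ∀ x, cdf (μ : Measure ℝ) x = limitCdf θ x) :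
    TendstoInDistribution
      (fun (n : ℕ) (T : RecursiveTree n) => (T.largestBranch : ℝ) / (n : ℝ)) atTop
      (id : ℝ → ℝ) (fun n => (hoppeTree θ hθ n).toMeasure) (μ : Measure ℝ) where
  forall_aemeasurable n := (measurable_recursiveTree _).aemeasurable
  aemeasurable_limit := aemeasurable_id
  tendsto := by
    refine tendsto_probabilityMeasure_of_tendsto_cdf fun x => ?_
    simp only [ProbabilityMeasure.coe_mk, Measure.map_id, hμ]
    have hev : (fun n : ℕ => if 0 ≤ x then hoppeCdf θ n x else 0) =ᶠ[atTop] fun n =>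
        cdf ((hoppeTree θ hθ n).toMeasure.map
          fun T : RecursiveTree n => (T.largestBranch : ℝ) / n) x := by
      filter_upwards [eventually_gt_atTop 0] with n hn
      exact (cdf_map_largestBranch hθ hn x).symm
    refine Tendsto.congr' hev ?_
    by_cases hx : 0 ≤ x
    · simp only [if_pos hx]
      exact tendsto_hoppeCdf_of_nonneg hθ hx
    · simp only [if_neg hx]
      rw [limitCdf, if_neg fun h => hx h.le]
      exact tendsto_const_nhds

/-! ### The uniform recursive tree -/

/-- At `θ = 1` the weight does not depend on the tree, and total mass `1` determines it. -/
theorem uniformRecursiveTree_eq_hoppeTree (n : ℕ) :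
    uniformRecursiveTree n = hoppeTree 1 one_pos n := by
  have hc : ∀ T S : RecursiveTree n, T.hoppeWeight 1 = S.hoppeWeight 1 := by
    intro T S
    simp [RecursiveTree.hoppeWeight]
  ext T
  have hsum := RecursiveTree.sum_hoppeWeight one_pos n
  rw [Finset.sum_congr rfl fun S _ => hc S T, Finset.sum_const, nsmul_eq_mul,
    Finset.card_univ] at hsum
  have hcard : (0 : ℝ) < Fintype.card (RecursiveTree n) := by exact_mod_cast Fintype.card_pos
  rw [uniformRecursiveTree, PMF.uniformOfFintype_apply, hoppeTree, PMF.ofFintype_apply,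
    eq_inv_of_mul_eq_one_right hsum, ENNReal.ofReal_inv_of_pos hcard, ENNReal.ofReal_natCast]

theorem urtF_eq_limitCdf (x : ℝ) : urtF x = limitCdf 1 x := by
  unfold urtF limitCdf
  rcases le_or_gt x 0 with hx | hx
  · rw [if_pos hx, if_neg (not_lt.2 hx)]
  · rw [if_neg (not_le.2 hx), if_pos hx]
    split_ifs with h1
    · rw [kingmanF_eq_tsum one_pos hx]
      congr 2
      funext k
      unfold kingmanTerm simplexIntegrand
      simp
    · exact (kingmanF_eq_one one_pos (not_le.1 h1).le).symm

/-- Two coordinates above `c ≥ 1/2` cannot sum to less than `1`, so only `k = 0` and `k = 1` remain,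
the latter being the integral of `1 / y` over `(c, 1)`. -/
theorem kingmanF_one_of_half_le {c : ℝ} (hc : 1 / 2 ≤ c) (hc1 : c ≤ 1) :
    kingmanF 1 c = 1 - Real.log c⁻¹ := by
  have hc0 : 0 < c := by linarith
  have h1 : limitMoment 1 c 1 1 = Real.log c⁻¹ := by
    have h2 : limitMoment 1 c 1 1 = ∫ y in Set.Ioo 0 (1 - c), 1 / (1 - y) := by
      simp [limitMoment]
    rw [h2, ← integral_Ioc_eq_integral_Ioo,
      ← intervalIntegral.integral_of_le (by linarith),
      intervalIntegral.integral_comp_sub_left (fun y : ℝ => 1 / y), sub_sub_cancel, sub_zero,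
      integral_one_div_of_pos hc0 one_pos, one_div]
  rw [kingmanF_eq_sum one_pos hc0 (K := 2) (by push_cast; linarith), Finset.sum_range_succ,
    Finset.sum_range_succ, Finset.sum_range_one, kingmanTerm_zero one_pos hc0,
    kingmanTerm_eq_zero (k := 2) (by push_cast; linarith), kingmanTerm_one_div one_pos hc0, h1]
  simp

namespace RecursiveTree

theorem sum_branchSizes {n : ℕ} (T : RecursiveTree n) : T.branchSizes.sum = n - 1 := by
  have h := T.sum_rootChildren (fun _ => 1) (fun _ => 1) fun _ _ _ _ => rfl
  simp only [Finset.sum_const, Nat.card_Icc, nsmul_eq_mul, mul_one] at h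
  have h2 : T.branchSizes.sum = ∑ c ∈ T.rootChildren, (T.subtree c).ncard := rfl
  rw [h2]
  have h3 : n + 1 - 2 = ∑ c ∈ T.rootChildren, (T.subtree c).ncard := by exact_mod_cast h
  omega

theorem largestBranch_le {n : ℕ} (T : RecursiveTree n) : T.largestBranch ≤ n := by
  refine csSup_le' fun s hs => ?_
  have := (Finset.mem_Icc.1 hs.1).2
  omega

theorem sum_sq_branchSizes_le {n : ℕ} (T : RecursiveTree n) :
    (T.branchSizes.map fun s : ℕ => (s : ℝ) ^ 2).sum ≤ ((n - 1 : ℕ) : ℝ) * T.largestBranch := by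
  have h := (T.largestBranch_le_iff (T.largestBranch.cast_nonneg (α := ℝ))).1 le_rfl
  calc _ ≤ (T.branchSizes.map fun s : ℕ => (s : ℝ) * T.largestBranch).sum :=
        Multiset.sum_map_le_sum_map _ _ fun s hs => by
          rw [sq]; exact mul_le_mul_of_nonneg_left (h s hs) s.cast_nonneg
    _ = _ := by
        rw [Multiset.sum_map_mul_right, ← T.sum_branchSizes, Nat.cast_multiset_sum]

end RecursiveTree

/-- With `m = n - 1`, the expected sum of squares is `m * (m + 1) / 2`, and it is at most `m` times
the expected largest branch. -/
theorem half_le_integral_largestBranch {n : ℕ} (hn : 2 ≤ n) :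
    (n : ℝ) / 2 ≤ ∫ T, (T.largestBranch : ℝ) ∂(uniformRecursiveTree n).toMeasure := by
  obtain ⟨m, rfl⟩ : ∃ m, n = m + 1 := ⟨n - 1, by omega⟩
  have hm : (0 : ℝ) < m := by exact_mod_cast (by omega : 0 < m)
  have h1 := RecursiveTree.sum_hoppeWeight_mul one_pos m
    fun l => (l.map fun s : ℕ => (s : ℝ) ^ 2).sum
  rw [crp_sum_sq, crpMass_one, div_one] at h1
  rw [uniformRecursiveTree_eq_hoppeTree, integral_hoppeTree]
  refine le_of_mul_le_mul_left ?_ hm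
  calc (m : ℝ) * (((m + 1 : ℕ) : ℝ) / 2) = m * (m + 1) / 2 := by push_cast; ring
    _ ≤ _ := by
      rw [← h1, Finset.mul_sum]
      refine Finset.sum_le_sum fun T _ => ?_
      rw [mul_left_comm]
      exact mul_le_mul_of_nonneg_left T.sum_sq_branchSizes_le
        (RecursiveTree.hoppeWeight_nonneg one_pos T)

theorem ae_mem_Ioc_of_cdf {θ : ℝ} (hθ : 0 < θ) {μ : ProbabilityMeasure ℝ}
    (hμ : ∀ x, cdf (μ : Measure ℝ) x = limitCdf θ x) :
    ∀ᵐ x ∂(μ : Measure ℝ), x ∈ Set.Ioc (0 : ℝ) 1 := by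
  have h : (μ : Measure ℝ) (Set.Ioc 0 1) = 1 := by
    conv_lhs => rw [← measure_cdf (μ : Measure ℝ)]
    rw [StieltjesFunction.measure_Ioc, hμ, hμ, limitCdf, limitCdf, if_pos one_pos,
      if_neg (lt_irrefl _), kingmanF_eq_one hθ le_rfl, sub_zero, ENNReal.ofReal_one]
  exact (prob_compl_eq_zero_iff measurableSet_Ioc).2 h

/-- The identity is not a bounded test function, but it agrees with its truncation to `[0, 1]` on a
set carrying all the laws, so the bound for finite `n` passes to the limit. -/
theorem half_le_integral_of_tendstoInDistribution {μ : ProbabilityMeasure ℝ}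
    (hae : ∀ᵐ x ∂(μ : Measure ℝ), x ∈ Set.Ioc (0 : ℝ) 1)
    (h : TendstoInDistribution
      (fun (n : ℕ) (T : RecursiveTree n) => (T.largestBranch : ℝ) / (n : ℝ)) atTop
      (id : ℝ → ℝ) (fun n => (uniformRecursiveTree n).toMeasure) (μ : Measure ℝ)) :
    1 / 2 ≤ ∫ x, x ∂(μ : Measure ℝ) := by
  let clamp : BoundedContinuousFunction ℝ ℝ := BoundedContinuousFunction.ofNormedAddCommGroup
    (fun x => max 0 (min x 1)) (by fun_prop) 1 fun x => by
      rw [Real.norm_of_nonneg (le_max_left _ _)]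
      exact max_le zero_le_one (min_le_right _ _)
  have hclamp : ∀ x : ℝ, 0 ≤ x → x ≤ 1 → clamp x = x := by
    intro x h0 h1
    change max 0 (min x 1) = x
    rw [min_eq_left h1, max_eq_right h0]
  have hlim := (ProbabilityMeasure.tendsto_iff_forall_integral_tendsto.1 h.tendsto) clamp
  simp only [ProbabilityMeasure.coe_mk, Measure.map_id] at hlim
  have hint : ∫ x, clamp x ∂(μ : Measure ℝ) = ∫ x, x ∂(μ : Measure ℝ) := by
    refine integral_congr_ae ?_
    filter_upwards [hae] with x hx
    exact hclamp x hx.1.le hx.2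
  rw [hint] at hlim
  refine ge_of_tendsto hlim ?_
  filter_upwards [eventually_ge_atTop 2] with n hn
  have hn' : (0 : ℝ) < n := by positivity
  rw [integral_map (measurable_recursiveTree _).aemeasurable
    clamp.continuous.measurable.aestronglyMeasurable]
  have h2 : ∀ T : RecursiveTree n, clamp ((T.largestBranch : ℝ) / n) = (T.largestBranch : ℝ) / n :=
    fun T => hclamp _ (by positivity)
      (div_le_one_of_le₀ (by exact_mod_cast T.largestBranch_le) n.cast_nonneg)
  simp only [h2]
  rw [integral_div, le_div_iff₀ hn']
  have := half_le_integral_largestBranch hn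
  linarith

theorem theorem4p1 :
    -- (i) Hoppe trees
    (∀ (θ : ℝ) (hθ : 0 < θ),
      (∀ x : ℝ, 0 < x →
        (∀ k : ℕ, IntegrableOn (simplexIntegrand θ (k + 1)) (simplexRegion (k + 1) (1 / x))) ∧
        Summable (fun k : ℕ => kingmanTerm θ (k + 1) (1 / x))) ∧
      ∃ μ : ProbabilityMeasure ℝ,
        (∀ x : ℝ, cdf (μ : Measure ℝ) x = if 0 < x then kingmanF θ x else 0) ∧
        TendstoInDistribution
          (fun (n : ℕ) (T : RecursiveTree n) => (T.largestBranch : ℝ) / (n : ℝ)) atTop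
          (id : ℝ → ℝ) (fun n => (hoppeTree θ hθ n).toMeasure) (μ : Measure ℝ)) ∧
    -- (ii) uniform recursive trees
    (∃ μ : ProbabilityMeasure ℝ,
      (∀ x : ℝ, cdf (μ : Measure ℝ) x = urtF x) ∧
      TendstoInDistribution
        (fun (n : ℕ) (T : RecursiveTree n) => (T.largestBranch : ℝ) / (n : ℝ)) atTop
        (id : ℝ → ℝ) (fun n => (uniformRecursiveTree n).toMeasure) (μ : Measure ℝ) ∧
      Integrable (fun x : ℝ => x) (μ : Measure ℝ) ∧
      1 / 2 ≤ ∫ x, x ∂(μ : Measure ℝ)) ∧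
    (∀ c ∈ Set.Icc (1 / 2 : ℝ) 1,
      Tendsto
        (fun n : ℕ => (uniformRecursiveTree n).toMeasure.real
          {T : RecursiveTree n | (T.largestBranch : ℝ) ≤ c * (n : ℝ)})
        atTop (𝓝 (1 - Real.log c⁻¹))) ∧
    (∀ n : ℕ, 2 ≤ n →
      (n : ℝ) / 2 ≤ ∫ T, (T.largestBranch : ℝ) ∂(uniformRecursiveTree n).toMeasure) := by
  refine ⟨fun θ hθ => ⟨fun x hx => ⟨fun k => ?_, summable_kingmanTerm hx⟩, ?_⟩, ?_, ?_,
    fun n hn => half_le_integral_largestBranch hn⟩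
  · rw [simplexRegion_one_div]
    exact integrableOn_truncatedIntegrand hθ hx (k + 1)
  · obtain ⟨μ, hμ⟩ := exists_limitMeasure hθ
    exact ⟨μ, hμ, tendstoInDistribution_largestBranch hθ hμ⟩
  · obtain ⟨μ, hμ⟩ := exists_limitMeasure one_pos
    have hae := ae_mem_Ioc_of_cdf one_pos hμ
    have ht := tendstoInDistribution_largestBranch one_pos hμ
    simp only [← uniformRecursiveTree_eq_hoppeTree] at ht
    refine ⟨μ, fun x => (hμ x).trans (urtF_eq_limitCdf x).symm, ht, ?_,
      half_le_integral_of_tendstoInDistribution hae ht⟩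
    refine Integrable.mono' (integrable_const (1 : ℝ)) measurable_id.aestronglyMeasurable ?_
    filter_upwards [hae] with x hx
    rw [Real.norm_of_nonneg hx.1.le]
    exact hx.2
  · rintro c ⟨hc, hc1⟩
    have hc0 : 0 < c := by linarith
    have h := tendsto_hoppeCdf one_pos hc0
    rw [kingmanF_one_of_half_le hc hc1] at h
    refine h.congr' ?_
    filter_upwards [eventually_gt_atTop 0] with n hn
    rw [uniformRecursiveTree_eq_hoppeTree, measureReal_largestBranch_le one_pos hn hc0.le]
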